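/- Let $k\le 0$ be an even integer and let $N,\nu$ be positive integers. For a function $f$ on the upper half-plane $\mathfrak H$ and an integral matrix $A=\begin{pmatrix}a&b\\c&d\end{pmatrix}$ of positive determinant put $(f|_kA)(\tau)=(\det A)^{k/2}(c\tau+d)^{-k}f\left(\frac{a\tau+b}{c\tau+d}\right)$. For $\tau=x+iy\in\mathfrak H$ and real $s$ let $$\varphi_{\nu,s}(\tau)=\frac{1}{\Gamma(2-k)}(4\pi\nu y)^{-k/2}M_{-k/2,\,s-1/2}(4\pi\nu y)\,e^{-2\pi i\nu x},$$ where $M_{\kappa,\mu}(w)=e^{-w/2}w^{\mu+1/2}{}_1F_1(\mu-\kappa+\tfrac12;1+2\mu;w)$ is the Whittaker function, and let $$F^{(N,k)}_\nu(\tau,s)=\sum_{\gamma\in\Gamma_\infty\backslash\Gamma_0(N)}(\varphi_{\nu,s}|_k\gamma)(\tau),$$ where $\Gamma_\infty$ is the stabilizer of $\infty$ in $\Gamma_0(N)$. The Maass–Poincaré series of weight $k$ and level $N$, normalized to have principal part $q^{-\nu}+O(1)$ at $\infty$ (where $q=e^{2\pi i\tau}$), is $P^{(N,k)}_\nu(\tau)=\lim_{s\to(1-k/2)^+}F^{(N,k)}_\nu(\tau,s)$;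 for $k<0$ this is the absolutely convergent series $F^{(N,k)}_\nu(\tau,1-k/2)$, and for $k=0$ it is the continuation of $F^{(N,0)}_\nu(\tau,s)$ from $s>1$ to $s=1$. These series are well defined: for every $\tau\in\mathfrak H$ the series $F^{(N,k)}_\nu(\tau,s)$ converges absolutely for all $s>1$, and the limit defining $P^{(N,k)}_\nu(\tau)$ exists. Moreover, $$P^{(N,k)}_\nu=\sum_{d\mid\gcd(N,\nu)}(\nu/d)^{1-k}\,P^{(N/d,k)}_1\,\big|\,T^{(N/d)}_{\nu/d}\,\big|\,B_d .$$ Here, for $f$ invariant under $|_k\gamma$ for all $\gamma\in\Gamma_0(M)$, the $m$-th Hecke operator of level $M$ is $f|T_m^{(M)}=m^{k/2-1}\sum_{\beta\in\Gamma_0(M)\backslash\mathcal M_m(M)}f|_k\beta$, where $\mathcal M_m(M)$ is the set of integral matrices $\begin{pmatrix}a&b\\c&d\end{pmatrix}$ with determinant $m$, $M\mid c$ and $\gcd(a,M)=1$; and $(f|B_d)(\tau)=f(d\tau)$. -/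

import Mathlib

open UpperHalfPlane Filter Topology
open scoped MatrixGroups

noncomputable section

namespace MaassPoincare

/-- The weight `k` slash operator
`(f|_k A)(τ) = (det A)^{k/2} (cτ+d)^{-k} f((aτ+b)/(cτ+d))` for an integral matrix
`A = (a b; c d)` of positive determinant. The point `(aτ+b)/(cτ+d)` has positive imaginary part,
so that `ofComplex` is merely its reinterpretation as an element of `ℍ`. -/
def slash (k : ℤ) (A : Matrix (Fin 2) (Fin 2) ℤ) (f : ℍ → ℂ) (τ : ℍ) : ℂ :=
  (((A.det : ℝ) ^ ((k : ℝ) / 2) : ℝ) : ℂ) * ((A 1 0 : ℂ) * τ + (A 1 1 : ℂ)) ^ (-k) *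
    f (ofComplex (((A 0 0 : ℂ) * τ + (A 0 1 : ℂ)) / ((A 1 0 : ℂ) * τ + (A 1 1 : ℂ))))

/-! ### Hecke operators and the operators `B_d` -/

/-- The set `ℳ_m(N)` of integral matrices `(a b; c d)` with determinant `m`, `N ∣ c` and
`gcd(a, N) = 1`. -/
def heckeSet (N m : ℕ) : Set (Matrix (Fin 2) (Fin 2) ℤ) :=
  {A | A.det = m ∧ (N : ℤ) ∣ A 1 0 ∧ IsCoprime (A 0 0) (N : ℤ)}

/-- Two elements of `ℳ_m(N)` are equivalent if they differ by left multiplication by an element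
of `Γ₀(N)`. The quotient is `Γ₀(N) \ ℳ_m(N)`. -/
def heckeSetoid (N m : ℕ) : Setoid (heckeSet N m) where
  r A B := ∃ γ ∈ CongruenceSubgroup.Gamma0 N,
    (γ : Matrix (Fin 2) (Fin 2) ℤ) * (A : Matrix (Fin 2) (Fin 2) ℤ) = B
  iseqv :=
    { refl := fun A => ⟨1, one_mem _, by simp⟩
      symm := by
        rintro A B ⟨γ, hγ, h⟩
        refine ⟨γ⁻¹, inv_mem hγ, ?_⟩
        rw [← h, ← Matrix.mul_assoc, ← Matrix.SpecialLinearGroup.coe_mul]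
        simp
      trans := by
        rintro A B C ⟨γ, hγ, h⟩ ⟨δ, hδ, h'⟩
        refine ⟨δ * γ, mul_mem hδ hγ, ?_⟩
        rw [Matrix.SpecialLinearGroup.coe_mul, Matrix.mul_assoc, h, h'] }

/-- The Hecke operator `f|T_m^{(N)} = m^{k/2-1} ∑_{β ∈ Γ₀(N) \ ℳ_m(N)} f|_k β` on functions `f`
that are invariant under the weight `k` slash action of `Γ₀(N)` (for those, the choice of
representatives is irrelevant). For `m ≥ 1` the sum is finite. -/
def heckeT (N : ℕ) (k : ℤ) (m : ℕ) (f : ℍ → ℂ) (τ : ℍ) : ℂ :=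
  (((m : ℝ) ^ ((k : ℝ) / 2 - 1) : ℝ) : ℂ) *
    ∑ᶠ β : Quotient (heckeSetoid N m), slash k (β.out : Matrix (Fin 2) (Fin 2) ℤ) f τ

/-- `(f|B_d)(τ) = f(dτ)`, for `d ≥ 1`. -/
def opB (d : ℕ) (f : ℍ → ℂ) (τ : ℍ) : ℂ := f (ofComplex ((d : ℂ) * τ))

/-! ### The Whittaker function and the seed -/

/-- Kummer's confluent hypergeometric function `₁F₁(a; b; w) = ∑ (a)ₙ / (b)ₙ wⁿ / n!`. -/
def kummer (a b w : ℝ) : ℝ :=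
  ∑' n : ℕ, (ascPochhammer ℝ n).eval a / (ascPochhammer ℝ n).eval b * w ^ n / (n.factorial : ℝ)

/-- The Whittaker function
`M_{κ,μ}(w) = e^{-w/2} w^{μ+1/2} ₁F₁(μ - κ + 1/2; 1 + 2μ; w)`, for `w > 0`. -/
def whittakerM (κ μ w : ℝ) : ℝ :=
  Real.exp (-w / 2) * w ^ (μ + 1 / 2) * kummer (μ - κ + 1 / 2) (1 + 2 * μ) w

/-- The seed function
`φ_{ν,s}(τ) = Γ(2-k)⁻¹ (4πνy)^{-k/2} M_{-k/2, s-1/2}(4πνy) e^{-2πiνx}`, where `τ = x + iy`.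
With this normalization, at `s = 1 - k/2` it equals
`(1 - Γ(1-k, 4πνy) / Γ(1-k)) q^{-ν}`, that is, `q^{-ν}` up to exponential decay as `y → ∞`. -/
def seed (k : ℤ) (ν : ℕ) (s : ℝ) (τ : ℍ) : ℂ :=
  (((Real.Gamma (2 - k))⁻¹ * (4 * Real.pi * ν * τ.im) ^ (-(k : ℝ) / 2) *
      whittakerM (-(k : ℝ) / 2) (s - 1 / 2) (4 * Real.pi * ν * τ.im) : ℝ) : ℂ) *
    Complex.exp (-2 * Real.pi * Complex.I * ν * τ.re)

/-! ### The Maass-Poincare series -/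

/-- The stabilizer of the cusp `∞` in `SL₂(ℤ)`: the matrices `(a b; 0 d)`. -/
def stabInfty : Subgroup SL(2, ℤ) where
  carrier := {γ | γ 1 0 = 0}
  one_mem' := by simp
  mul_mem' := by
    intro a b ha hb
    simp only [Set.mem_ofPred_eq] at ha hb ⊢
    simp [Matrix.SpecialLinearGroup.coe_mul, Matrix.mul_apply, Fin.sum_univ_two, ha, hb]
  inv_mem' := by
    intro a ha
    simp only [Set.mem_ofPred_eq] at ha ⊢
    simp [Matrix.SpecialLinearGroup.coe_inv, Matrix.adjugate_fin_two, ha]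

/-- The set of right cosets `Γ_∞ \ Γ₀(N)`, where `Γ_∞` is the stabilizer of `∞` in `Γ₀(N)`. -/
abbrev Cosets (N : ℕ) : Type :=
  Quotient (QuotientGroup.rightRel (stabInfty.subgroupOf (CongruenceSubgroup.Gamma0 N)))

/-- The summand `(φ_{ν,s}|_k γ)(τ)` of the Poincare series. For even `k` it depends only on the
coset of `γ`. -/
def term (N : ℕ) (k : ℤ) (ν : ℕ) (τ : ℍ) (s : ℝ) (γ : Cosets N) : ℂ :=
  slash k ((γ.out : SL(2, ℤ)) : Matrix (Fin 2) (Fin 2) ℤ) (seed k ν s) τ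

/-- The Poincare series `∑_{γ ∈ Γ_∞ \ Γ₀(N)} φ_{ν,s}|_k γ`, absolutely convergent for `s > 1`. -/
def series (N : ℕ) (k : ℤ) (ν : ℕ) (τ : ℍ) (s : ℝ) : ℂ :=
  ∑' γ : Cosets N, term N k ν τ s γ

/-- The Maass-Poincare series `P_ν^{(N,k)}` of weight `k ≤ 0` and level `N`, with principal part
`q^{-ν}` at `∞`: the value at `s = 1 - k/2` of the series above. For `k < 0` this point lies in
the region of absolute convergence, where the series is continuous in `s`; for `k = 0` it is the
boundary point `s = 1`, and the value is obtained by continuation from `s > 1`. -/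
def poincare (N : ℕ) (k : ℤ) (ν : ℕ) (τ : ℍ) : ℂ :=
  limUnder (𝓝[>] (1 - (k : ℝ) / 2)) (series N k ν τ)

end MaassPoincare

end

/-!
# Hecke relations for Maass-Poincaré series

**Convergence.** The summand attached to `γ = (a b; c d)` is bounded by a constant times
`|cτ + d|^{-2s}` (`norm_slash_seed`, `exists_norm_slash_seed_le`), which gives absolute convergence
for `s > 1`. For `k < 0` the point `1 - k/2` lies in this region and the limit is the value of the
series there (`tendsto_series_of_neg`).

**The limit in weight zero.** For `k = 0` the limit point `s = 1` is on the boundary. Replacing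
the seed by its leading term at `y = 0`, and `Re (γτ)` by `a/c`, changes the summand by
`O(|cτ + d|^{-3})`, uniformly for `1 ≤ s ≤ 2` (`exists_norm_slash_seed_sub_mainTerm_le`). What
remains is `∑_c ∑_d e(-ν d̄ / c) |cτ + d|^{-2s}`, where `d̄` is the inverse of `d` modulo `c`. In
the row `c`, the finite Fourier transform of `d ↦ e(-ν d̄ / c)` consists of Kloosterman sums to the
modulus `c`, and the sums `∑_d e(nd/c) |cτ + d|^{-2s}` are estimated by summation by parts. An upper
bound `O(c^{11/12} d(c))` for the Kloosterman sums, where `d(c)` is the number of divisors,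
therefore bounds the row by a summable function of `c`, uniformly up to `s = 1` (`norm_tsum_invChar_le`,
`summable_row_bound`), and the limit exists by dominated convergence
(`exists_tendsto_series_zero`). The bound, `norm_kloosterman_le`, is Kloosterman's: since
`S(um, u⁻¹n; c) = S(m, n; c)`, a single sum contributes `φ(c)` times to a fourth moment, which
counts the solutions of `x₁ + x₂ = x₃ + x₄`, `ν (x₁⁻¹ + x₂⁻¹) = ν (x₃⁻¹ + x₄⁻¹)` in units modulo `c`.

**The Hecke relation.** It is proved for every `s > 1` (`series_eq_sum_heckeT`) and passes to the
limit. The powers of `ν/d` cancel, and the right-hand side becomes, up to the factor `ν^{-k/2}`, a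
sum of `φ_{1,s} |_k γ β diag(e, 1)` over `e ∣ gcd(N, ν)`, `β ∈ Γ₀(N/e) \ ℳ_{ν/e}(N/e)` and
`γ ∈ Γ_∞ \ Γ₀(N/e)`. These products run exactly once through all integral matrices `(a b; c d)` of
determinant `ν` with `N ∣ c`, modulo `Γ_∞`, where `e` is recovered as `gcd(a, N)`
(`heckeMap_injective`, `heckeMap_surjective`). Left multiplication by `(1 1/g; 0 1)`, where
`g = gcd(c, d)`, permutes these classes and multiplies the summand by `e(-1/g)`, so that only the
classes with `g = 1` contribute (`tsum_detTerm_eq`). They are the classes of `diag(ν, 1) γ` with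
`γ ∈ Γ_∞ \ Γ₀(N)` (`tsum_coprime_eq`), and `φ_{1,s}(νz) = φ_{ν,s}(z)`.
-/

noncomputable section

namespace MaassPoincare

/-! ### The slash operator -/

/-- The automorphy factor `cτ + d` of an integral matrix `A = (a b; c d)`. -/
def autj (A : Matrix (Fin 2) (Fin 2) ℤ) (τ : ℍ) : ℂ := (A 1 0 : ℂ) * τ + (A 1 1 : ℂ)

/-- The point `Aτ = (aτ + b)/(cτ + d)` of the upper half-plane, in the encoding used by `slash`;
it is meaningful for matrices of positive determinant. -/
def mob (A : Matrix (Fin 2) (Fin 2) ℤ) (τ : ℍ) : ℍ :=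
  ofComplex (((A 0 0 : ℂ) * τ + (A 0 1 : ℂ)) / autj A τ)

lemma slash_eq (k : ℤ) (A : Matrix (Fin 2) (Fin 2) ℤ) (f : ℍ → ℂ) (τ : ℍ) :
    slash k A f τ = (((A.det : ℝ) ^ ((k : ℝ) / 2) : ℝ) : ℂ) * autj A τ ^ (-k) * f (mob A τ) := rfl

lemma autj_ne_zero {A : Matrix (Fin 2) (Fin 2) ℤ} (hA : A.det ≠ 0) (τ : ℍ) : autj A τ ≠ 0 := by
  intro h
  have him := congrArg Complex.im h
  have hre := congrArg Complex.re h
  simp only [autj, Complex.add_im, Complex.mul_im, Complex.intCast_re, Complex.intCast_im,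
    Complex.add_re, Complex.mul_re, Complex.zero_im, Complex.zero_re, coe_im, coe_re] at him hre
  have h0 : A 1 0 = 0 := by
    have : (A 1 0 : ℝ) * τ.im = 0 := by linarith
    rcases mul_eq_zero.1 this with h | h
    · exact_mod_cast h
    · exact absurd h τ.im_ne_zero
  have h1 : A 1 1 = 0 := by
    have : (A 1 1 : ℝ) = 0 := by simpa [h0] using hre
    exact_mod_cast this
  apply hA
  rw [Matrix.det_fin_two, h0, h1]; simp

lemma im_aux {A : Matrix (Fin 2) (Fin 2) ℤ} (hA : A.det ≠ 0) (τ : ℍ) :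
    (((A 0 0 : ℂ) * τ + (A 0 1 : ℂ)) / autj A τ).im = A.det * τ.im / ‖autj A τ‖ ^ 2 := by
  have h := autj_ne_zero hA τ
  have h' : Complex.normSq (autj A τ) ≠ 0 := by simpa using h
  rw [← Complex.normSq_eq_norm_sq, Complex.div_im, ← sub_div]
  congr 1
  rw [Matrix.det_fin_two]
  simp [autj]
  ring

lemma coe_mob {A : Matrix (Fin 2) (Fin 2) ℤ} (hA : 0 < A.det) (τ : ℍ) :
    (mob A τ : ℂ) = ((A 0 0 : ℂ) * τ + (A 0 1 : ℂ)) / autj A τ := by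
  have h : 0 < (((A 0 0 : ℂ) * τ + (A 0 1 : ℂ)) / autj A τ).im := by
    rw [im_aux hA.ne']
    have := autj_ne_zero hA.ne' τ
    have h2 : (0 : ℝ) < A.det := by exact_mod_cast hA
    have := τ.im_pos
    positivity
  rw [mob, ofComplex_apply_of_im_pos h]

lemma im_mob {A : Matrix (Fin 2) (Fin 2) ℤ} (hA : 0 < A.det) (τ : ℍ) :
    (mob A τ).im = A.det * τ.im / ‖autj A τ‖ ^ 2 := by
  rw [← im_aux hA.ne', ← coe_mob hA, coe_im]

lemma autj_mul {A B : Matrix (Fin 2) (Fin 2) ℤ} (hB : 0 < B.det) (τ : ℍ) :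
    autj (A * B) τ = autj A (mob B τ) * autj B τ := by
  have h := autj_ne_zero hB.ne' τ
  have e : autj A (mob B τ) = (A 1 0 : ℂ) * (mob B τ : ℂ) + (A 1 1 : ℂ) := rfl
  rw [e, coe_mob hB, add_mul, mul_assoc, div_mul_cancel₀ _ h]
  simp only [autj, Matrix.mul_apply, Fin.sum_univ_two]
  push_cast
  ring

lemma mob_mul {A B : Matrix (Fin 2) (Fin 2) ℤ} (hA : 0 < A.det) (hB : 0 < B.det) (τ : ℍ) :
    mob (A * B) τ = mob A (mob B τ) := by
  have h := autj_ne_zero hB.ne' τ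
  have h2 := autj_ne_zero hA.ne' (mob B τ)
  have hAB : 0 < (A * B).det := by rw [Matrix.det_mul]; positivity
  apply UpperHalfPlane.ext
  rw [coe_mob hAB, coe_mob hA, autj_mul hB, div_eq_div_iff (mul_ne_zero h2 h) h2, coe_mob hB,
    Matrix.mul_apply, Matrix.mul_apply]
  simp only [Fin.sum_univ_two]
  push_cast
  field_simp
  simp only [autj] at h ⊢
  ring

/-- The slash operator is a right action of the integral matrices of positive determinant. -/
lemma slash_mul (k : ℤ) {A B : Matrix (Fin 2) (Fin 2) ℤ} (hA : 0 < A.det) (hB : 0 < B.det)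
    (f : ℍ → ℂ) (τ : ℍ) : slash k (A * B) f τ = slash k B (slash k A f) τ := by
  have hA' : (0 : ℝ) ≤ A.det := by exact_mod_cast hA.le
  have hB' : (0 : ℝ) ≤ B.det := by exact_mod_cast hB.le
  simp only [slash_eq]
  rw [mob_mul hA hB, autj_mul hB, mul_zpow, Matrix.det_mul, Int.cast_mul,
    Real.mul_rpow hA' hB']
  push_cast
  ring

lemma seed_vadd (k : ℤ) (ν : ℕ) (s : ℝ) (j : ℤ) {τ τ' : ℍ} (h : (τ' : ℂ) = τ + j) :
    seed k ν s τ' = seed k ν s τ := by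
  have him : τ'.im = τ.im := by
    have := congrArg Complex.im h; simpa using this
  have hre : τ'.re = τ.re + j := by
    have := congrArg Complex.re h; simpa using this
  simp only [seed, him, hre]
  congr 1
  push_cast
  rw [show -2 * (Real.pi : ℂ) * Complex.I * ν * (τ.re + j) =
    -2 * Real.pi * Complex.I * ν * τ.re + ((-(ν * j : ℤ) : ℤ) : ℂ) * (2 * Real.pi * Complex.I) by
      push_cast; ring, Complex.exp_add, Complex.exp_int_mul_two_pi_mul_I, mul_one]

/-- A matrix in the stabilizer of `∞` is `±` a translation. -/
lemma entries_of_mem_stabInfty {γ : SL(2, ℤ)} (h : γ ∈ stabInfty) :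
    γ 1 0 = 0 ∧ γ 0 0 = γ 1 1 ∧ γ 1 1 * γ 1 1 = 1 := by
  have h0 : γ 1 0 = 0 := h
  have hd := γ.det_coe
  rw [Matrix.det_fin_two, h0, mul_zero, sub_zero] at hd
  refine ⟨h0, ?_⟩
  rcases Int.isUnit_iff.1 (IsUnit.of_mul_eq_one _ hd) with h1 | h1 <;>
    · rw [h1] at hd ⊢
      have : γ 1 1 = 1 ∨ γ 1 1 = -1 := by omega
      rcases this with h | h <;> rw [h] at hd ⊢ <;> simp at hd ⊢

/-- For even weight, the seed is invariant under the stabilizer of `∞`. -/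
lemma slash_stabInfty_mul_seed {k : ℤ} (hk : Even k) (ν : ℕ) (s : ℝ) {γ : SL(2, ℤ)}
    (hγ : γ ∈ stabInfty) {A : Matrix (Fin 2) (Fin 2) ℤ} (hA : 0 < A.det) (τ : ℍ) :
    slash k ((γ : Matrix (Fin 2) (Fin 2) ℤ) * A) (seed k ν s) τ = slash k A (seed k ν s) τ := by
  obtain ⟨h0, h1, h2⟩ := entries_of_mem_stabInfty hγ
  have hdet : (γ : Matrix (Fin 2) (Fin 2) ℤ).det = 1 := γ.det_coe
  rw [slash_mul k (by rw [hdet]; norm_num) hA, slash_eq k A, slash_eq k A]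
  congr 1
  generalize mob A τ = z
  rw [slash_eq, hdet]
  have hj : autj (γ : Matrix (Fin 2) (Fin 2) ℤ) z = (γ 1 1 : ℂ) := by simp [autj, h0]
  have hu : (γ 1 1 : ℂ) * (γ 1 1 : ℂ) = 1 := by exact_mod_cast h2
  have hne : (γ 1 1 : ℂ) ≠ 0 := left_ne_zero_of_mul_eq_one hu
  have hp : (γ 1 1 : ℂ) ^ (-k) = 1 := by
    obtain ⟨m, rfl⟩ := hk
    rw [neg_add, zpow_add₀ hne, ← mul_zpow, hu, one_zpow]
  rw [hj, hp, seed_vadd k ν s (γ 1 1 * γ 0 1) (τ := z)]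
  · simp
  · rw [coe_mob (by rw [hdet]; norm_num), hj, h1]
    push_cast
    rw [div_eq_iff hne]
    linear_combination (-(γ 0 1 : ℂ)) * hu

/-! ### Estimates for the seed -/

lemma abs_pochhammer_quotient_le {R a b : ℝ} (hR : 1 ≤ R) (ha : |a| ≤ R) (hb : 1 ≤ b) (n : ℕ) :
    |(ascPochhammer ℝ n).eval a / (ascPochhammer ℝ n).eval b| ≤ R ^ n := by
  induction n with
  | zero => simp
  | succ n ih =>
    have hn : (0 : ℝ) ≤ n := n.cast_nonneg
    rw [ascPochhammer_succ_eval, ascPochhammer_succ_eval, mul_div_mul_comm, abs_mul, pow_succ]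
    refine mul_le_mul ih ?_ (abs_nonneg _) (by positivity)
    rw [abs_div, abs_of_pos (show 0 < b + n by linarith), div_le_iff₀ (by linarith)]
    calc |a + n| ≤ |a| + n := by simpa using abs_add_le a (n : ℝ)
      _ ≤ R * (b + n) := by nlinarith

lemma abs_kummer_term_le {R a b w : ℝ} (hR : 1 ≤ R) (ha : |a| ≤ R) (hb : 1 ≤ b) (hw : 0 ≤ w)
    (n : ℕ) :
    |(ascPochhammer ℝ n).eval a / (ascPochhammer ℝ n).eval b * w ^ n / (n.factorial : ℝ)| ≤
      (R * w) ^ n / (n.factorial : ℝ) := by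
  rw [abs_div, abs_mul, abs_of_nonneg (pow_nonneg hw n), mul_pow, Nat.abs_cast]
  have := abs_pochhammer_quotient_le hR ha hb n
  gcongr

lemma abs_kummer_le {R a b w : ℝ} (hR : 1 ≤ R) (ha : |a| ≤ R) (hb : 1 ≤ b) (hw : 0 ≤ w) :
    |kummer a b w| ≤ Real.exp (R * w) := by
  rw [Real.exp_eq_exp_ℝ, NormedSpace.exp_eq_tsum_div, kummer, ← Real.norm_eq_abs]
  exact tsum_of_norm_bounded (Real.summable_pow_div_factorial (R * w)).hasSum
    (abs_kummer_term_le hR ha hb hw)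

lemma abs_kummer_sub_one_le {R a b w : ℝ} (hR : 1 ≤ R) (ha : |a| ≤ R) (hb : 1 ≤ b)
    (hw : 0 ≤ w) : |kummer a b w - 1| ≤ Real.exp (R * w) - 1 := by
  have hs := Real.summable_pow_div_factorial (R * w)
  have hk : Summable fun n : ℕ ↦
      (ascPochhammer ℝ n).eval a / (ascPochhammer ℝ n).eval b * w ^ n / (n.factorial : ℝ) :=
    Summable.of_norm_bounded hs (abs_kummer_term_le hR ha hb hw)
  have he : Real.exp (R * w) - 1 = ∑' n : ℕ, (R * w) ^ (n + 1) / ((n + 1).factorial : ℝ) := by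
    rw [Real.exp_eq_exp_ℝ, NormedSpace.exp_eq_tsum_div]
    beta_reduce
    rw [hs.tsum_eq_zero_add]
    simp
  rw [kummer, hk.tsum_eq_zero_add, he]
  simp only [pow_zero, ascPochhammer_zero, Polynomial.eval_one, Nat.factorial_zero, Nat.cast_one,
    div_one, mul_one, add_sub_cancel_left]
  rw [← Real.norm_eq_abs]
  exact tsum_of_norm_bounded ((summable_nat_add_iff 1).2 hs).hasSum
    fun n ↦ abs_kummer_term_le hR ha hb hw (n + 1)

lemma continuousOn_kummer (q w S : ℝ) (hw : 0 ≤ w) :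
    ContinuousOn (fun s : ℝ ↦ kummer (s + q) (2 * s) w) (Set.Icc 1 S) := by
  unfold kummer
  refine continuousOn_tsum (u := fun n : ℕ ↦ ((1 + |S| + |q|) * w) ^ n / (n.factorial : ℝ))
    (fun n ↦ ?_) (Real.summable_pow_div_factorial _) fun n s hs ↦ ?_
  · have hne : ∀ s ∈ Set.Icc 1 S, (ascPochhammer ℝ n).eval (2 * s) ≠ 0 := fun s hs ↦
      (ascPochhammer_pos n (2 * s) (by linarith [hs.1])).ne'
    have h1 : Continuous fun s : ℝ ↦ (ascPochhammer ℝ n).eval (s + q) :=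
      (ascPochhammer ℝ n).continuous.comp (by fun_prop)
    have h2 : Continuous fun s : ℝ ↦ (ascPochhammer ℝ n).eval (2 * s) :=
      (ascPochhammer ℝ n).continuous.comp (by fun_prop)
    exact ((h1.continuousOn.div h2.continuousOn hne).mul continuousOn_const).div_const _
  · refine abs_kummer_term_le ?_ ?_ (by linarith [hs.1]) hw n
    · linarith [abs_nonneg S, abs_nonneg q]
    · have : |s| ≤ |S| := abs_le_abs_of_nonneg (by linarith [hs.1]) hs.2
      linarith [abs_add_le s q]

lemma seed_eq (k : ℤ) (ν : ℕ) (s : ℝ) (z : ℍ) {w : ℝ} (hw : w = 4 * Real.pi * ν * z.im) :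
    seed k ν s z = (((Real.Gamma (2 - k))⁻¹ * w ^ (-(k : ℝ) / 2) *
      (Real.exp (-w / 2) * w ^ s * kummer (s + k / 2) (2 * s) w) : ℝ) : ℂ) *
        Complex.exp (-2 * Real.pi * Complex.I * ν * z.re) := by
  rw [seed, ← hw, whittakerM, sub_add_cancel,
    show s - 1 / 2 - -(k : ℝ) / 2 + 1 / 2 = s + k / 2 by ring,
    show 1 + 2 * (s - 1 / 2) = 2 * s by ring]

lemma norm_exp_re (ν : ℕ) (x : ℝ) :
    ‖Complex.exp (-2 * Real.pi * Complex.I * ν * x)‖ = 1 := by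
  rw [show -2 * (Real.pi : ℂ) * Complex.I * ν * x = ((-2 * Real.pi * ν * x : ℝ) : ℂ) * Complex.I by
    push_cast; ring, Complex.norm_exp_ofReal_mul_I]

/-- The powers of `|cτ + d|` in the slash operator and in the seed combine to `|cτ + d|^{-2s}`,
independently of the weight. -/
lemma norm_slash_seed (k : ℤ) (hk : k ≤ 0) {ν : ℕ} (s : ℝ)
    {A : Matrix (Fin 2) (Fin 2) ℤ} (hA : A.det = 1) (τ : ℍ) {w : ℝ}
    (hw : w = 4 * Real.pi * ν * τ.im / ‖autj A τ‖ ^ 2) (hν : 0 < ν) :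
    ‖slash k A (seed k ν s) τ‖ = (Real.Gamma (2 - k))⁻¹ *
      (4 * Real.pi * ν * τ.im) ^ (s - k / 2) * ‖autj A τ‖ ^ (-2 * s) *
        (Real.exp (-w / 2) * |kummer (s + k / 2) (2 * s) w|) := by
  have ha : 0 < ‖autj A τ‖ := norm_pos_iff.2 (autj_ne_zero (by rw [hA]; norm_num) τ)
  have hy := τ.im_pos
  have hν' : (0 : ℝ) < ν := by exact_mod_cast hν
  have hG : 0 < Real.Gamma (2 - k) := Real.Gamma_pos_of_pos (by
    have : (k : ℝ) ≤ 0 := by exact_mod_cast hk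
    linarith)
  have hw0 : 0 < 4 * Real.pi * ν * τ.im := by positivity
  have hwp : 0 < w := by rw [hw]; positivity
  have hwe : w = 4 * Real.pi * ν * (mob A τ).im := by
    rw [hw, im_mob (by rw [hA]; norm_num), hA]; push_cast; ring
  have hpow : ‖autj A τ‖ ^ (-k) * (w ^ (-(k : ℝ) / 2) * w ^ s) =
      (4 * Real.pi * ν * τ.im) ^ (s - k / 2) * ‖autj A τ‖ ^ (-2 * s) := by
    rw [← Real.rpow_add hwp, hw, Real.div_rpow hw0.le (by positivity), ← Real.rpow_natCast,
      ← Real.rpow_mul ha.le, ← Real.rpow_intCast,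
      show -(k : ℝ) / 2 + s = s - k / 2 by ring,
      show -2 * s = ((-k : ℤ) : ℝ) - ((2 : ℕ) : ℝ) * (s - k / 2) by push_cast; ring,
      Real.rpow_sub ha]
    ring
  rw [slash_eq, seed_eq k ν s _ hwe, hA]
  simp only [Int.cast_one, Real.one_rpow, Complex.ofReal_one, one_mul, norm_mul, norm_exp_re,
    norm_zpow, mul_one, Complex.norm_real, Real.norm_eq_abs]
  rw [abs_of_pos (inv_pos.2 hG), abs_of_pos (Real.rpow_pos_of_pos hwp _),
    abs_of_pos (Real.rpow_pos_of_pos hwp _), abs_of_pos (Real.exp_pos _)]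
  linear_combination ((Real.Gamma (2 - k))⁻¹ * (Real.exp (-w / 2) *
    |kummer (s + k / 2) (2 * s) w|)) * hpow

/-- A lower bound in `(0, 1]` for `|cτ + d|` over all integers `(c, d) ≠ (0, 0)`. -/
def lowerBd (τ : ℍ) : ℝ := min (EisensteinSeries.r τ) 1

lemma lowerBd_pos (τ : ℍ) : 0 < lowerBd τ := lt_min (EisensteinSeries.r_pos τ) one_pos

lemma lowerBd_le_one (τ : ℍ) : lowerBd τ ≤ 1 := min_le_right _ _

lemma lowerBd_mul_le (τ : ℍ) {c d : ℤ} (h : c ≠ 0 ∨ d ≠ 0) :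
    lowerBd τ * max |(c : ℝ)| |(d : ℝ)| ≤ ‖(c : ℂ) * τ + d‖ := by
  have hx : (![c, d] : Fin 2 → ℤ) ≠ 0 := by
    intro h0
    have h1 := congrFun h0 0
    have h2 := congrFun h0 1
    simp at h1 h2
    tauto
  have := EisensteinSeries.r_mul_max_le τ hx
  simp only [Matrix.cons_val_zero, Matrix.cons_val_one] at this
  refine le_trans ?_ this
  rw [EisensteinSeries.norm_eq_max_natAbs]
  simp only [Matrix.cons_val_zero, Matrix.cons_val_one]
  push_cast
  rw [Nat.cast_natAbs, Nat.cast_natAbs]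
  push_cast
  gcongr
  exact min_le_left _ _

lemma lowerBd_le (τ : ℍ) {c d : ℤ} (h : c ≠ 0 ∨ d ≠ 0) : lowerBd τ ≤ ‖(c : ℂ) * τ + d‖ := by
  refine le_trans ?_ (lowerBd_mul_le τ h)
  have : (1 : ℝ) ≤ max |(c : ℝ)| |(d : ℝ)| := by
    rcases h with h | h
    · exact le_max_of_le_left (by exact_mod_cast Int.one_le_abs h)
    · exact le_max_of_le_right (by exact_mod_cast Int.one_le_abs h)
  exact le_mul_of_one_le_right (lowerBd_pos τ).le this

lemma bottom_ne_zero {A : Matrix (Fin 2) (Fin 2) ℤ} (hA : A.det ≠ 0) : A 1 0 ≠ 0 ∨ A 1 1 ≠ 0 := by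
  by_contra! h
  exact hA (by rw [Matrix.det_fin_two, h.1, h.2]; simp)

lemma lowerBd_le_autj (τ : ℍ) {A : Matrix (Fin 2) (Fin 2) ℤ} (hA : A.det ≠ 0) :
    lowerBd τ ≤ ‖autj A τ‖ := lowerBd_le τ (bottom_ne_zero hA)

lemma rpow_neg_le_of_lower_bound {r a p q B : ℝ} (hr : 0 < r) (hr1 : r ≤ 1) (ha : r ≤ a)
    (hpq : p ≤ q) (hq : q ≤ p + B) : a ^ (-q) ≤ r ^ (-B) * a ^ (-p) := by
  have ha0 : 0 < a := hr.trans_le ha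
  rw [show -q = -(q - p) + -p by ring, Real.rpow_add ha0]
  gcongr
  calc a ^ (-(q - p)) ≤ r ^ (-(q - p)) := Real.rpow_le_rpow_of_nonpos hr ha (by linarith)
    _ ≤ r ^ (-B) := Real.rpow_le_rpow_of_exponent_ge hr hr1 (by linarith)

/-- A majorant of the summands that is uniform for `s` in a right neighbourhood of `s₀`. -/
lemma exists_norm_slash_seed_le (k : ℤ) (hk : k ≤ 0) {ν : ℕ} (hν : 0 < ν) (τ : ℍ) {s₀ : ℝ}
    (hs₀ : 1 ≤ s₀) : ∃ C : ℝ, ∀ s ∈ Set.Icc s₀ (s₀ + 1), ∀ A : Matrix (Fin 2) (Fin 2) ℤ,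
      A.det = 1 → ‖slash k A (seed k ν s) τ‖ ≤ C * ‖autj A τ‖ ^ (-(2 * s₀)) := by
  set w₀ : ℝ := 4 * Real.pi * ν * τ.im with hw₀
  have hy := τ.im_pos
  have hk' : (k : ℝ) ≤ 0 := by exact_mod_cast hk
  have hw₀p : 0 < w₀ := by positivity
  have hr := lowerBd_pos τ
  have hG : 0 < Real.Gamma (2 - k) := Real.Gamma_pos_of_pos (by linarith)
  set R : ℝ := s₀ + 1 + |(k : ℝ)| with hR
  refine ⟨(Real.Gamma (2 - k))⁻¹ * (1 + w₀) ^ (s₀ + 1 - k / 2) * lowerBd τ ^ (-2 : ℝ) *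
    Real.exp (R * (w₀ / lowerBd τ ^ 2)), fun s hs A hA ↦ ?_⟩
  have hdet : A.det ≠ 0 := by rw [hA]; norm_num
  have ha := lowerBd_le_autj τ hdet
  have ha0 : 0 < ‖autj A τ‖ := hr.trans_le ha
  set w := w₀ / ‖autj A τ‖ ^ 2 with hw
  have hwp : 0 < w := by positivity
  have hwle : w ≤ w₀ / lowerBd τ ^ 2 := by rw [hw]; gcongr
  rw [norm_slash_seed k hk s hA τ hw hν]
  have h1 : w₀ ^ (s - k / 2) ≤ (1 + w₀) ^ (s₀ + 1 - k / 2) :=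
    calc w₀ ^ (s - k / 2) ≤ (1 + w₀) ^ (s - k / 2) :=
          Real.rpow_le_rpow hw₀p.le (by linarith) (by linarith [hs.1])
      _ ≤ _ := Real.rpow_le_rpow_of_exponent_le (by linarith) (by linarith [hs.2])
  have h2 : ‖autj A τ‖ ^ (-2 * s) ≤ lowerBd τ ^ (-2 : ℝ) * ‖autj A τ‖ ^ (-(2 * s₀)) := by
    rw [neg_mul]
    exact rpow_neg_le_of_lower_bound hr (lowerBd_le_one τ) ha (by linarith [hs.1])
      (by linarith [hs.2])
  have h3 : Real.exp (-w / 2) * |kummer (s + k / 2) (2 * s) w| ≤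
      Real.exp (R * (w₀ / lowerBd τ ^ 2)) := by
    have hRk : |s + (k : ℝ) / 2| ≤ R := by
      have : |(k : ℝ) / 2| ≤ |(k : ℝ)| := by
        rw [abs_div, abs_two]; linarith [abs_nonneg (k : ℝ)]
      have h4 : |s| = s := abs_of_nonneg (by linarith [hs.1])
      linarith [abs_add_le s ((k : ℝ) / 2), hs.2]
    have hR1 : 1 ≤ R := by linarith [abs_nonneg (k : ℝ)]
    calc Real.exp (-w / 2) * |kummer (s + k / 2) (2 * s) w| ≤ 1 * Real.exp (R * w) := by
          gcongr
          · exact Real.exp_le_one_iff.2 (by linarith)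
          · exact abs_kummer_le hR1 hRk (by linarith [hs.1]) hwp.le
      _ ≤ _ := by rw [one_mul]; gcongr
  calc _ ≤ (Real.Gamma (2 - k))⁻¹ * (1 + w₀) ^ (s₀ + 1 - k / 2) *
        (lowerBd τ ^ (-2 : ℝ) * ‖autj A τ‖ ^ (-(2 * s₀))) *
          Real.exp (R * (w₀ / lowerBd τ ^ 2)) := by gcongr
    _ = _ := by ring

lemma continuousOn_slash_seed (k : ℤ) (ν : ℕ) (hν : 0 < ν)
    {A : Matrix (Fin 2) (Fin 2) ℤ} (τ : ℍ) (S : ℝ) :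
    ContinuousOn (fun s ↦ slash k A (seed k ν s) τ) (Set.Icc 1 S) := by
  have hy := (mob A τ).im_pos
  have hw : 0 < 4 * Real.pi * ν * (mob A τ).im := by positivity
  simp only [slash_eq]
  refine continuousOn_const.mul ?_
  simp only [seed_eq k ν _ _ rfl]
  refine ContinuousOn.mul ?_ continuousOn_const
  refine Complex.continuous_ofReal.comp_continuousOn ?_
  refine continuousOn_const.mul ((continuousOn_const.mul ?_).mul
    (continuousOn_kummer _ _ _ hw.le))
  exact (Real.continuous_const_rpow hw.ne').continuousOn

/-! ### Cosets and absolute convergence -/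

/-- The chosen representative of a coset, as an integral matrix. -/
def rep {N : ℕ} (γ : Cosets N) : Matrix (Fin 2) (Fin 2) ℤ := ((γ.out : SL(2, ℤ)) : _)

lemma term_eq (N : ℕ) (k : ℤ) (ν : ℕ) (τ : ℍ) (s : ℝ) (γ : Cosets N) :
    term N k ν τ s γ = slash k (rep γ) (seed k ν s) τ := rfl

lemma det_rep {N : ℕ} (γ : Cosets N) : (rep γ).det = 1 := (γ.out : SL(2, ℤ)).det_coe

lemma mul_inv_mem_stabInfty_iff (x y : SL(2, ℤ)) :
    y * x⁻¹ ∈ stabInfty ↔ y 1 0 * x 1 1 = y 1 1 * x 1 0 := by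
  have : (y * x⁻¹) 1 0 = y 1 0 * x 1 1 - y 1 1 * x 1 0 := by
    rw [Matrix.SpecialLinearGroup.coe_mul, Matrix.mul_apply]
    simp [Fin.sum_univ_two, Matrix.SpecialLinearGroup.coe_inv, Matrix.adjugate_fin_two]
    ring
  change (y * x⁻¹) 1 0 = 0 ↔ _
  rw [this, sub_eq_zero]

/-- Cosets of `Γ_∞` are determined by the bottom row up to proportionality. -/
lemma coset_mk_eq_iff {N : ℕ} (x y : CongruenceSubgroup.Gamma0 N) :
    (Quotient.mk _ x : Cosets N) = Quotient.mk _ y ↔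
      (y : SL(2, ℤ)) 1 0 * (x : SL(2, ℤ)) 1 1 = (y : SL(2, ℤ)) 1 1 * (x : SL(2, ℤ)) 1 0 := by
  rw [Quotient.eq, QuotientGroup.rightRel_apply, Subgroup.mem_subgroupOf,
    ← mul_inv_mem_stabInfty_iff]
  rfl

lemma coset_eq_iff {N : ℕ} (γ δ : Cosets N) :
    γ = δ ↔ rep δ 1 0 * rep γ 1 1 = rep δ 1 1 * rep γ 1 0 := by
  conv_lhs => rw [← Quotient.out_eq γ, ← Quotient.out_eq δ]
  exact coset_mk_eq_iff _ _

lemma summable_norm_autj_rpow (N : ℕ) (τ : ℍ) {p : ℝ} (hp : 2 < p) :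
    Summable fun γ : Cosets N ↦ ‖autj (rep γ) τ‖ ^ (-p) := by
  have hinj : Function.Injective fun γ : Cosets N ↦ (![rep γ 1 0, rep γ 1 1] : Fin 2 → ℤ) := by
    intro γ δ h
    have h1 := congrFun h 0
    have h2 := congrFun h 1
    simp only [Matrix.cons_val_zero, Matrix.cons_val_one] at h1 h2
    rw [coset_eq_iff, h1, h2, mul_comm]
  refine Summable.of_nonneg_of_le (fun _ ↦ by positivity) (fun γ ↦ ?_)
    (((EisensteinSeries.summable_one_div_norm_rpow hp).mul_left
      (EisensteinSeries.r τ ^ (-p))).comp_injective hinj)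
  simpa [autj] using EisensteinSeries.summand_bound τ (by linarith : (0 : ℝ) ≤ p)
    ![rep γ 1 0, rep γ 1 1]

lemma summable_term (N : ℕ) (k : ℤ) (hk : k ≤ 0) {ν : ℕ} (hν : 0 < ν) (τ : ℍ) {s : ℝ}
    (hs : 1 < s) : Summable (term N k ν τ s) := by
  obtain ⟨C, hC⟩ := exists_norm_slash_seed_le k hk hν τ hs.le
  refine Summable.of_norm_bounded ((summable_norm_autj_rpow N τ
    (by linarith : 2 < 2 * s)).mul_left C) fun γ ↦ ?_
  exact hC s ⟨le_rfl, by linarith⟩ _ (det_rep γ)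

/-- In negative weight the series converges at `s = 1 - k/2 > 1`, and is continuous there from
the right. -/
lemma tendsto_series_of_neg (N : ℕ) (k : ℤ) (hk : k < 0) {ν : ℕ} (hν : 0 < ν) (τ : ℍ) :
    Tendsto (series N k ν τ) (𝓝[>] (1 - (k : ℝ) / 2)) (𝓝 (series N k ν τ (1 - (k : ℝ) / 2))) := by
  have hk' : (k : ℝ) < 0 := by exact_mod_cast hk
  set s₀ : ℝ := 1 - (k : ℝ) / 2 with hs₀
  have h1 : 1 < s₀ := by linarith
  obtain ⟨C, hC⟩ := exists_norm_slash_seed_le k hk.le hν τ h1.le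
  have hsub : Set.Ioc s₀ (s₀ + 1) ∈ 𝓝[>] s₀ := Ioc_mem_nhdsGT (by linarith)
  refine tendsto_tsum_of_dominated_convergence
    (bound := fun γ : Cosets N ↦ C * ‖autj (rep γ) τ‖ ^ (-(2 * s₀)))
    ((summable_norm_autj_rpow N τ (by linarith)).mul_left C) (fun γ ↦ ?_) ?_
  · have hc : ContinuousOn (fun s ↦ term N k ν τ s γ) (Set.Icc 1 (s₀ + 1)) :=
      continuousOn_slash_seed k ν hν τ (s₀ + 1)
    exact ((hc s₀ ⟨h1.le, by linarith⟩).mono_left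
      (nhdsWithin_le_of_mem (mem_of_superset hsub fun s hs ↦ ⟨by linarith [hs.1], hs.2⟩)))
  · filter_upwards [hsub] with s hs γ
    exact hC s ⟨hs.1.le, hs.2⟩ _ (det_rep γ)

/-! ### Kloosterman sums -/

section Kloosterman
variable {c : ℕ} [NeZero c]

/-- The Kloosterman sum `S(m, n; c)`. -/
def kloosterman (m n : ZMod c) : ℂ :=
  ∑ x : (ZMod c)ˣ, ZMod.stdAddChar (m * (x : ZMod c) + n * ((x⁻¹ : (ZMod c)ˣ) : ZMod c))

lemma kloosterman_units_mul (m n : ZMod c) (u : (ZMod c)ˣ) :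
    kloosterman ((u : ZMod c) * m) (((u⁻¹ : (ZMod c)ˣ) : ZMod c) * n) = kloosterman m n := by
  refine Fintype.sum_equiv (Equiv.mulLeft u) _ _ fun x ↦ ?_
  congr 1
  simp only [Equiv.coe_mulLeft, mul_inv, Units.val_mul]
  ring

/-- The quadruples counted by the fourth moment of the Kloosterman sums. -/
def momentSet (t : ZMod c) : Finset ((ZMod c)ˣ × (ZMod c)ˣ × (ZMod c)ˣ × (ZMod c)ˣ) :=
  {x | ((x.1 : ZMod c) + (x.2.1 : ZMod c) - (x.2.2.1 : ZMod c) - (x.2.2.2 : ZMod c)) = 0 ∧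
    t * ((x.1⁻¹ : (ZMod c)ˣ) + (x.2.1⁻¹ : (ZMod c)ˣ) - (x.2.2.1⁻¹ : (ZMod c)ˣ) -
      (x.2.2.2⁻¹ : (ZMod c)ˣ) : ZMod c) = 0}

lemma norm_kloosterman_pow_four (m n : ZMod c) : ((‖kloosterman m n‖ ^ 4 : ℝ) : ℂ) =
    ∑ x : (ZMod c)ˣ × (ZMod c)ˣ × (ZMod c)ˣ × (ZMod c)ˣ,
      ZMod.stdAddChar (m * ((x.1 : ZMod c) + (x.2.1 : ZMod c) - (x.2.2.1 : ZMod c) -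
        (x.2.2.2 : ZMod c))) *
      ZMod.stdAddChar (n * ((x.1⁻¹ : (ZMod c)ˣ) + (x.2.1⁻¹ : (ZMod c)ˣ) -
        (x.2.2.1⁻¹ : (ZMod c)ˣ) - (x.2.2.2⁻¹ : (ZMod c)ˣ) : ZMod c)) := by
  have h1 : ((‖kloosterman m n‖ ^ 4 : ℝ) : ℂ) = kloosterman m n * (kloosterman m n *
      (starRingEnd ℂ (kloosterman m n) * starRingEnd ℂ (kloosterman m n))) := by
    have := Complex.mul_conj (kloosterman m n)
    rw [Complex.normSq_eq_norm_sq] at this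
    calc ((‖kloosterman m n‖ ^ 4 : ℝ) : ℂ) = ((‖kloosterman m n‖ ^ 2 : ℝ) : ℂ) ^ 2 := by
          push_cast; ring
      _ = _ := by rw [← this]; ring
  have h2 : starRingEnd ℂ (kloosterman m n) =
      ∑ x : (ZMod c)ˣ,
        ZMod.stdAddChar (-(m * (x : ZMod c) + n * ((x⁻¹ : (ZMod c)ˣ) : ZMod c))) := by
    rw [kloosterman, map_sum]
    exact Finset.sum_congr rfl fun x _ ↦ (AddChar.map_neg_eq_conj _ _).symm
  rw [h1, h2, kloosterman]
  rw [Finset.sum_mul_sum, ← Fintype.sum_prod_type', Finset.sum_mul_sum, ← Fintype.sum_prod_type',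
    Finset.sum_mul_sum, ← Fintype.sum_prod_type']
  refine Finset.sum_congr rfl fun x _ ↦ ?_
  simp only [← AddChar.map_add_eq_mul]
  congr 1
  ring

/-- The fourth moment, over the first argument and over the multiples of `t` in the second, is a
count of solutions, by orthogonality of characters. -/
lemma sum_norm_kloosterman_pow_four (t : ZMod c) :
    ∑ p : ZMod c × ZMod c, ‖kloosterman p.1 (p.2 * t)‖ ^ 4 =
      (c : ℝ) ^ 2 * (momentSet t).card := by
  have hψ := ZMod.isPrimitive_stdAddChar c
  have : ((∑ p : ZMod c × ZMod c, ‖kloosterman p.1 (p.2 * t)‖ ^ 4 : ℝ) : ℂ) =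
      (c : ℂ) ^ 2 * (momentSet t).card := by
    rw [Complex.ofReal_sum]
    simp only [norm_kloosterman_pow_four]
    rw [Finset.sum_comm, momentSet, Finset.card_filter, Nat.cast_sum, Finset.mul_sum]
    refine Finset.sum_congr rfl fun x _ ↦ ?_
    rw [Fintype.sum_prod_type]
    simp only [mul_assoc _ t]
    rw [← Finset.sum_mul_sum, AddChar.sum_mulShift _ hψ, AddChar.sum_mulShift _ hψ, ZMod.card]
    split_ifs <;> simp_all
    ring
  exact_mod_cast this

/-- By `kloosterman_units_mul`, each value occurs at least `φ(c)` times in the fourth moment. -/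
lemma totient_mul_norm_kloosterman_le (m t : ZMod c) :
    (c.totient : ℝ) * ‖kloosterman m t‖ ^ 4 ≤ (c : ℝ) ^ 2 * (momentSet t).card := by
  rw [← sum_norm_kloosterman_pow_four, ← ZMod.card_units_eq_totient]
  have hinj : Function.Injective fun u : (ZMod c)ˣ ↦
      (((u : ZMod c) * m, ((u⁻¹ : (ZMod c)ˣ) : ZMod c)) : ZMod c × ZMod c) := by
    intro u v h
    simpa [Units.ext_iff.symm] using (Prod.ext_iff.1 h).2
  calc (Fintype.card (ZMod c)ˣ : ℝ) * ‖kloosterman m t‖ ^ 4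
      = ∑ u : (ZMod c)ˣ,
          ‖kloosterman ((u : ZMod c) * m) (((u⁻¹ : (ZMod c)ˣ) : ZMod c) * t)‖ ^ 4 := by
        simp [kloosterman_units_mul]
    _ = ∑ p ∈ Finset.univ.map ⟨_, hinj⟩, ‖kloosterman p.1 (p.2 * t)‖ ^ 4 := by
        rw [Finset.sum_map]; rfl
    _ ≤ _ := Finset.sum_le_univ_sum_of_nonneg fun _ ↦ by positivity

/-- The residues sharing a large factor with the modulus. -/
def largeGcd (c ν : ℕ) [NeZero c] : Finset (ZMod c) := {z | c ≤ ν * (z.val.gcd c) ^ 3}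

lemma exists_mem_largeGcd {ν : ℕ} (hν : 0 < ν) {u v w : ZMod c}
    (h : (ν : ZMod c) * (u * v * w) = 0) :
    u ∈ largeGcd c ν ∨ v ∈ largeGcd c ν ∨ w ∈ largeGcd c ν := by
  have hc : 0 < c := Nat.pos_of_ne_zero (NeZero.ne c)
  simp only [largeGcd, Finset.mem_filter, Finset.mem_univ, true_and]
  have h1 : c ∣ ν * (u.val * v.val * w.val) := by
    rw [← ZMod.natCast_eq_zero_iff]
    push_cast
    simpa using h
  have h2 : c ∣ ν * (u.val.gcd c * v.val.gcd c * w.val.gcd c) := by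
    have a1 : c ∣ (ν * (u.val * v.val * w.val)).gcd c := Nat.dvd_gcd h1 dvd_rfl
    have a2 := Nat.gcd_mul_left_dvd_mul_gcd
    have key : ∀ a b : ℕ, (a * b).gcd c ∣ a.gcd c * b.gcd c := fun a b ↦ by
      rw [Nat.gcd_comm, Nat.gcd_comm a, Nat.gcd_comm b]
      exact Nat.gcd_mul_right_dvd_mul_gcd c a b
    refine a1.trans ((key _ _).trans (mul_dvd_mul (Nat.gcd_dvd_left _ _) ?_))
    exact (key _ _).trans (mul_dvd_mul (key _ _) dvd_rfl)
  have h3 := Nat.le_of_dvd (Nat.mul_pos hν (by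
    have : ∀ z : ZMod c, 0 < z.val.gcd c := fun z ↦ Nat.gcd_pos_of_pos_right _ hc
    exact Nat.mul_pos (Nat.mul_pos (this u) (this v)) (this w))) h2
  set g₁ := u.val.gcd c
  set g₂ := v.val.gcd c
  set g₃ := w.val.gcd c
  have key : ∀ g, g₁ ≤ g → g₂ ≤ g → g₃ ≤ g → c ≤ ν * g ^ 3 := fun g h₁ h₂ h₃ ↦ by
    refine h3.trans (Nat.mul_le_mul_left _ ?_)
    calc g₁ * g₂ * g₃ ≤ g * g * g := by gcongr
      _ = g ^ 3 := by ring
  rcases le_total g₁ g₂ with h12 | h12 <;> rcases le_total g₂ g₃ with h23 | h23 <;>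
    rcases le_total g₁ g₃ with h13 | h13
  all_goals first
    | exact Or.inl (key _ le_rfl (by omega) (by omega))
    | exact Or.inr (Or.inl (key _ (by omega) le_rfl (by omega)))
    | exact Or.inr (Or.inr (key _ (by omega) (by omega) le_rfl))

/-- After elimination of the fourth unknown and of the inverses, the equations that define
`momentSet` read `ν (x₁ + x₂)(x₃ - x₁)(x₃ - x₂) = 0`, so that one of the three factors lies in
`largeGcd`. -/
lemma card_momentSet_le {ν : ℕ} (hν : 0 < ν) {t : ZMod c} (ht : t = ν ∨ t = -ν) :
    (momentSet t).card ≤ 3 * c ^ 2 * (largeGcd c ν).card := by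
  set B := largeGcd c ν
  let S : Finset (ZMod c × ZMod c × ZMod c) := B ×ˢ Finset.univ ×ˢ Finset.univ
  have hS : S.card = B.card * (c * c) := by
    simp [S, Finset.card_product, ZMod.card]
  -- The three ways in which a triple `(x₁, x₂, x₃)` can have a form with a large common factor
  let f₁ : ZMod c × ZMod c × ZMod c → ZMod c × ZMod c × ZMod c := fun p ↦
    (p.1 - p.2.1, p.2.1, p.2.2)
  let f₂ : ZMod c × ZMod c × ZMod c → ZMod c × ZMod c × ZMod c := fun p ↦
    (p.2.1, p.2.2, p.1 + p.2.1)
  let f₃ : ZMod c × ZMod c × ZMod c → ZMod c × ZMod c × ZMod c := fun p ↦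
    (p.2.1, p.2.2, p.1 + p.2.2)
  have hsub : (momentSet t).card ≤ (S.image f₁ ∪ (S.image f₂ ∪ S.image f₃)).card := by
    refine Finset.card_le_card_of_injOn
      (fun x ↦ ((x.1 : ZMod c), (x.2.1 : ZMod c), (x.2.2.1 : ZMod c))) ?_ ?_
    · rintro ⟨x, y, z, w⟩ hx
      simp only [momentSet, Finset.coe_filter, Finset.mem_univ, true_and, Set.mem_ofPred_eq] at hx
      obtain ⟨hA, hB⟩ := hx
      simp only [Finset.coe_union, Finset.coe_image, Set.mem_union, Set.mem_image,
        Finset.mem_coe, S, Finset.mem_product, Finset.mem_univ, and_true, Prod.exists,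
        Prod.mk.injEq, f₁, f₂, f₃]
      have hx := x.mul_inv
      have hy := y.mul_inv
      have hz := z.mul_inv
      have hw := w.mul_inv
      generalize ((x⁻¹ : (ZMod c)ˣ) : ZMod c) = x' at *
      generalize ((y⁻¹ : (ZMod c)ˣ) : ZMod c) = y' at *
      generalize ((z⁻¹ : (ZMod c)ˣ) : ZMod c) = z' at *
      generalize ((w⁻¹ : (ZMod c)ˣ) : ZMod c) = w' at *
      generalize (x : ZMod c) = X at *
      generalize (y : ZMod c) = Y at *
      generalize (z : ZMod c) = Z at *
      generalize (w : ZMod c) = W at *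
      have hW : W = X + Y - Z := by linear_combination -hA
      have h1 : t * ((X + Y) * (Z - X) * (Z - Y)) = 0 := by
        have : t * (Y * Z * W + X * Z * W - X * Y * W - X * Y * Z) = 0 := by
          linear_combination X * Y * Z * W * hB - t * Y * Z * W * hx - t * X * Z * W * hy +
            t * X * Y * W * hz + t * X * Y * Z * hw
        rw [hW] at this
        linear_combination -this
      have h2 : (ν : ZMod c) * ((X + Y) * (Z - X) * (Z - Y)) = 0 := by
        rcases ht with rfl | rfl
        · exact h1
        · linear_combination -h1
      rcases exists_mem_largeGcd hν h2 with h | h | h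
      · exact Or.inl ⟨X + Y, Y, Z, h, by ring, rfl, rfl⟩
      · exact Or.inr (Or.inl ⟨Z - X, X, Y, h, rfl, rfl, by ring⟩)
      · exact Or.inr (Or.inr ⟨Z - Y, X, Y, h, rfl, rfl, by ring⟩)
    · rintro ⟨x, y, z, w⟩ hx ⟨x', y', z', w'⟩ hx' h
      simp only [momentSet, Finset.coe_filter, Finset.mem_univ, true_and, Set.mem_ofPred_eq,
        Prod.mk.injEq] at hx hx' h
      obtain ⟨h1, h2, h3⟩ := h
      have h4 : (w : ZMod c) = w' := by
        linear_combination hx'.1 - hx.1 + h1 + h2 - h3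
      rw [Prod.mk.injEq, Prod.mk.injEq, Prod.mk.injEq]
      exact ⟨Units.ext h1, Units.ext h2, Units.ext h3, Units.ext h4⟩
  calc (momentSet t).card ≤ _ := hsub
    _ ≤ S.card + (S.card + S.card) := by
      refine (Finset.card_union_le _ _).trans (add_le_add Finset.card_image_le ?_)
      exact (Finset.card_union_le _ _).trans (add_le_add Finset.card_image_le Finset.card_image_le)
    _ = 3 * c ^ 2 * B.card := by rw [hS]; ring

lemma card_dvd_val_le {g : ℕ} (hg : g ∣ c) :
    (Finset.univ.filter fun z : ZMod c ↦ g ∣ z.val).card ≤ c / g := by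
  have hc : 0 < c := Nat.pos_of_ne_zero (NeZero.ne c)
  have hg0 : 0 < g := Nat.pos_of_dvd_of_pos hg hc
  have : (Finset.univ.filter fun z : ZMod c ↦ g ∣ z.val).card ≤ (Finset.range (c / g)).card := by
    refine Finset.card_le_card_of_injOn (fun z ↦ z.val / g) ?_ ?_
    · intro z hz
      simp only [Finset.coe_range, Set.mem_Iio]
      exact Nat.div_lt_div_of_lt_of_dvd hg z.val_lt
    · intro z hz z' hz' h
      simp only [Finset.coe_filter, Finset.mem_univ, true_and, Set.mem_ofPred_eq] at hz hz'
      apply ZMod.val_injective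
      rw [← Nat.div_mul_cancel hz, ← Nat.div_mul_cancel hz']
      exact congrArg (· * g) h
  simpa using this

lemma card_largeGcd_le (ν : ℕ) :
    ((largeGcd c ν).card : ℝ) ≤ c.divisors.card * (ν * (c : ℝ) ^ (2 / 3 : ℝ)) := by
  have hc : 0 < c := Nat.pos_of_ne_zero (NeZero.ne c)
  have hsub : largeGcd c ν ⊆ (c.divisors.filter fun g ↦ c ≤ ν * g ^ 3).biUnion fun g ↦
      Finset.univ.filter fun z : ZMod c ↦ g ∣ z.val := by
    intro z hz
    simp only [largeGcd, Finset.mem_filter, Finset.mem_univ, true_and] at hz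
    simp only [Finset.mem_biUnion, Finset.mem_filter, Finset.mem_univ, true_and, Nat.mem_divisors]
    exact ⟨z.val.gcd c, ⟨⟨Nat.gcd_dvd_right _ _, hc.ne'⟩, hz⟩, Nat.gcd_dvd_left _ _⟩
  have hfib : ∀ g ∈ c.divisors.filter fun g ↦ c ≤ ν * g ^ 3,
      ((Finset.univ.filter fun z : ZMod c ↦ g ∣ z.val).card : ℝ) ≤
        ν * (c : ℝ) ^ (2 / 3 : ℝ) := by
    intro g hg
    obtain ⟨hg, hgc⟩ := Finset.mem_filter.1 hg
    have hgd := Nat.dvd_of_mem_divisors hg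
    have hg0 : 0 < g := Nat.pos_of_dvd_of_pos hgd hc
    have hν : 1 ≤ ν := by
      rcases Nat.eq_zero_or_pos ν with rfl | h
      · omega
      · exact h
    refine (Nat.cast_le.2 (card_dvd_val_le hgd)).trans ?_
    rw [← pow_le_pow_iff_left₀ (by positivity) (by positivity) (three_ne_zero), mul_pow,
      ← Real.rpow_mul_natCast (by positivity)]
    norm_num
    obtain ⟨q, rfl⟩ := hgd
    rw [Nat.mul_div_cancel_left _ hg0]
    have h1 : q ^ 3 ≤ ν ^ 3 * (g * q) ^ 2 := by
      have h2 : q ≤ ν * g ^ 2 := by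
        have : g * q ≤ g * (ν * g ^ 2) := by
          linarith [hgc, show ν * g ^ 3 = g * (ν * g ^ 2) by ring]
        exact Nat.le_of_mul_le_mul_left this hg0
      have h3 : ν ≤ ν ^ 3 := Nat.le_self_pow (by norm_num) ν
      calc q ^ 3 = q * q ^ 2 := by ring
        _ ≤ (ν * g ^ 2) * q ^ 2 := by gcongr
        _ ≤ (ν ^ 3 * g ^ 2) * q ^ 2 := by gcongr
        _ = _ := by ring
    exact_mod_cast h1
  calc ((largeGcd c ν).card : ℝ) ≤ ∑ g ∈ c.divisors.filter fun g ↦ c ≤ ν * g ^ 3,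
        ((Finset.univ.filter fun z : ZMod c ↦ g ∣ z.val).card : ℝ) := by
        exact_mod_cast (Finset.card_le_card hsub).trans Finset.card_biUnion_le
    _ ≤ ∑ g ∈ c.divisors.filter fun g ↦ c ≤ ν * g ^ 3, ν * (c : ℝ) ^ (2 / 3 : ℝ) :=
        Finset.sum_le_sum hfib
    _ ≤ _ := by
        rw [Finset.sum_const, nsmul_eq_mul]
        gcongr
        exact Finset.filter_subset _ _

/-- From `n = ∑_{d ∣ n} φ(d)` and `φ(d) ≤ φ(n)`. -/
lemma le_totient_mul_card_divisors (n : ℕ) : n ≤ n.totient * n.divisors.card := by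
  rcases Nat.eq_zero_or_pos n with rfl | hn
  · simp
  calc n = ∑ d ∈ n.divisors, d.totient := (Nat.sum_totient n).symm
    _ ≤ ∑ d ∈ n.divisors, n.totient := Finset.sum_le_sum fun d hd ↦
        Nat.le_of_dvd (Nat.totient_pos.2 hn) (Nat.totient_dvd_of_dvd (Nat.dvd_of_mem_divisors hd))
    _ = _ := by rw [Finset.sum_const, smul_eq_mul, mul_comm]

/-- Kloosterman's bound, with a saving of `c^{1/12}` over the trivial one, uniformly in the first
argument. -/
theorem norm_kloosterman_le {ν : ℕ} (hν : 0 < ν) (m : ZMod c) {t : ZMod c}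
    (ht : t = ν ∨ t = -ν) :
    ‖kloosterman m t‖ ≤ 3 * ν * c.divisors.card * (c : ℝ) ^ (11 / 12 : ℝ) := by
  have hc : 0 < c := Nat.pos_of_ne_zero (NeZero.ne c)
  have hcR : (0 : ℝ) < c := by exact_mod_cast hc
  have hν1 : (1 : ℝ) ≤ ν := by exact_mod_cast hν
  set D : ℝ := ((c.divisors.card : ℕ) : ℝ) with hD
  have hD1 : 1 ≤ D := by
    rw [hD]; exact_mod_cast Finset.card_pos.2 ⟨1, Nat.one_mem_divisors.2 hc.ne'⟩
  have h1 := totient_mul_norm_kloosterman_le m t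
  have h2 : ((momentSet t).card : ℝ) ≤ 3 * (c : ℝ) ^ 2 * (D * (ν * (c : ℝ) ^ (2 / 3 : ℝ))) := by
    calc ((momentSet t).card : ℝ) ≤ 3 * (c : ℝ) ^ 2 * (largeGcd c ν).card := by
          exact_mod_cast card_momentSet_le hν ht
      _ ≤ _ := by gcongr; exact card_largeGcd_le ν
  have h3 : (c : ℝ) ≤ c.totient * D := by
    rw [hD]; exact_mod_cast le_totient_mul_card_divisors c
  have h4 : (c : ℝ) * ‖kloosterman m t‖ ^ 4 ≤
      c * (3 * ν * D ^ 2 * (c : ℝ) ^ (11 / 3 : ℝ)) := by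
    have e : (c : ℝ) ^ (11 / 3 : ℝ) = (c : ℝ) ^ 3 * (c : ℝ) ^ (2 / 3 : ℝ) := by
      rw [← Real.rpow_natCast, ← Real.rpow_add hcR]; norm_num
    calc (c : ℝ) * ‖kloosterman m t‖ ^ 4 ≤ c.totient * D * ‖kloosterman m t‖ ^ 4 := by gcongr
      _ = D * (c.totient * ‖kloosterman m t‖ ^ 4) := by ring
      _ ≤ D * ((c : ℝ) ^ 2 * (momentSet t).card) := by gcongr
      _ ≤ D * ((c : ℝ) ^ 2 * (3 * (c : ℝ) ^ 2 * (D * (ν * (c : ℝ) ^ (2 / 3 : ℝ))))) := by gcongr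
      _ = _ := by rw [e]; ring
  have h5 := le_of_mul_le_mul_left h4 hcR
  rw [← pow_le_pow_iff_left₀ (norm_nonneg _) (by positivity) (four_ne_zero), mul_pow,
    ← Real.rpow_mul_natCast hcR.le]
  norm_num
  refine h5.trans ?_
  gcongr
  calc 3 * ν * D ^ 2 ≤ (3 * ν * D ^ 2) * (27 * ν ^ 3 * D ^ 2) :=
        le_mul_of_one_le_right (by positivity) (by
          have : (1 : ℝ) ≤ ν ^ 3 := one_le_pow₀ hν1
          have : (1 : ℝ) ≤ D ^ 2 := one_le_pow₀ hD1
          nlinarith)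
    _ = (3 * ν * D) ^ 4 := by ring

end Kloosterman

/-! ### The sum over one row -/

lemma sum_range_inv_sq_le (c n : ℕ) (hc : 0 < c) :
    ∑ i ∈ Finset.range n, (1 : ℝ) / ((c : ℝ) + i) ^ 2 ≤ 2 / c := by
  have hc' : (0 : ℝ) < c := by exact_mod_cast hc
  have key : ∑ i ∈ Finset.range n, (1 : ℝ) / ((c : ℝ) + i) ^ 2 ≤ 2 / c - 2 / (c + n) := by
    induction n with
    | zero => simp
    | succ n ih =>
      rw [Finset.sum_range_succ]
      have hn : (0 : ℝ) ≤ n := n.cast_nonneg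
      have h1 : (1 : ℝ) ≤ c := by exact_mod_cast hc
      have : (1 : ℝ) / ((c : ℝ) + n) ^ 2 ≤ 2 / (c + n) - 2 / (c + (n + 1)) := by
        rw [div_sub_div _ _ (by positivity) (by positivity),
          div_le_div_iff₀ (by positivity) (by positivity)]
        nlinarith [mul_nonneg hn hn, mul_nonneg hn hc'.le]
      push_cast
      linarith
  have : (0 : ℝ) ≤ 2 / (c + n) := by positivity
  linarith

/-- The values of `|cτ + d|` on the row `c`. -/
def rowNorm (τ : ℍ) (c : ℕ) (d : ℤ) : ℝ := ‖(c : ℂ) * τ + d‖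

lemma lowerBd_mul_le_rowNorm (τ : ℍ) {c : ℕ} (hc : 0 < c) (d : ℤ) :
    lowerBd τ * max (c : ℝ) |(d : ℝ)| ≤ rowNorm τ c d := by
  have := lowerBd_mul_le τ (c := c) (d := d) (Or.inl (by exact_mod_cast hc.ne'))
  simpa [rowNorm] using this

lemma lowerBd_mul_natCast_le_rowNorm (τ : ℍ) {c : ℕ} (hc : 0 < c) (d : ℤ) :
    lowerBd τ * c ≤ rowNorm τ c d :=
  (mul_le_mul_of_nonneg_left (le_max_left _ _) (lowerBd_pos τ).le).trans
    (lowerBd_mul_le_rowNorm τ hc d)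

lemma lowerBd_le_rowNorm (τ : ℍ) {c : ℕ} (hc : 0 < c) (d : ℤ) : lowerBd τ ≤ rowNorm τ c d := by
  refine le_trans ?_ (lowerBd_mul_natCast_le_rowNorm τ hc d)
  exact le_mul_of_one_le_right (lowerBd_pos τ).le (by exact_mod_cast hc)

lemma rowNorm_pos (τ : ℍ) {c : ℕ} (hc : 0 < c) (d : ℤ) : 0 < rowNorm τ c d :=
  (lowerBd_pos τ).trans_le (lowerBd_le_rowNorm τ hc d)

lemma summable_rowNorm_two (τ : ℍ) {c : ℕ} (hc : 0 < c) :
    (Summable fun d : ℤ ↦ rowNorm τ c d ^ (-2 : ℝ)) ∧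
      ∑' d : ℤ, rowNorm τ c d ^ (-2 : ℝ) ≤ 16 / lowerBd τ ^ 2 / c := by
  have hr := lowerBd_pos τ
  have hc' : (0 : ℝ) < c := by exact_mod_cast hc
  set h : ℕ → ℝ := fun n ↦ 1 / ((c : ℝ) + n) ^ 2 with hh
  have hpos : ∀ n, 0 ≤ h n := fun n ↦ by positivity
  have hs : Summable h := summable_of_sum_range_le hpos fun n ↦ sum_range_inv_sq_le c n hc
  have hsum : ∑' n, h n ≤ 2 / c :=
    Real.tsum_le_of_sum_range_le hpos fun n ↦ sum_range_inv_sq_le c n hc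
  have hs1 : Summable fun n ↦ h (n + 1) := (summable_nat_add_iff 1).2 hs
  have hsum1 : ∑' n, h (n + 1) ≤ 2 / c := by
    rw [hs.tsum_eq_zero_add] at hsum
    linarith [hpos 0]
  have e1 : (fun n : ℕ ↦ h (n : ℤ).natAbs) = h := by ext n; simp
  have e2 : (fun n : ℕ ↦ h (-((n : ℤ) + 1)).natAbs) = fun n ↦ h (n + 1) := by
    ext n; congr 1
  have hZ : HasSum (fun d : ℤ ↦ h d.natAbs) (∑' n, h n + ∑' n, h (n + 1)) := by
    refine HasSum.of_nat_of_neg_add_one ?_ ?_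
    · rw [e1]; exact hs.hasSum
    · rw [e2]; exact hs1.hasSum
  have hle : ∀ d : ℤ, rowNorm τ c d ^ (-2 : ℝ) ≤ 4 / lowerBd τ ^ 2 * h d.natAbs := by
    intro d
    have h0 := rowNorm_pos τ hc d
    have h1 : lowerBd τ * (((c : ℝ) + d.natAbs) / 2) ≤ rowNorm τ c d := by
      refine le_trans ?_ (lowerBd_mul_le_rowNorm τ hc d)
      gcongr
      rw [Nat.cast_natAbs]
      push_cast
      linarith [le_max_left (c : ℝ) |(d : ℝ)|, le_max_right (c : ℝ) |(d : ℝ)|]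
    rw [Real.rpow_neg h0.le, Real.rpow_two]
    have h2 : (0 : ℝ) ≤ d.natAbs := Nat.cast_nonneg _
    calc (rowNorm τ c d ^ 2)⁻¹ ≤ ((lowerBd τ * (((c : ℝ) + d.natAbs) / 2)) ^ 2)⁻¹ := by gcongr
      _ = _ := by rw [hh]; field_simp; norm_num
  have hZ' := hZ.mul_left (4 / lowerBd τ ^ 2)
  have hS : Summable fun d : ℤ ↦ rowNorm τ c d ^ (-2 : ℝ) :=
    Summable.of_nonneg_of_le (fun d ↦ Real.rpow_nonneg (rowNorm_pos τ hc d).le _) hle hZ'.summable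
  refine ⟨hS, (hS.tsum_le_tsum hle hZ'.summable).trans ?_⟩
  rw [hZ'.tsum_eq]
  calc 4 / lowerBd τ ^ 2 * (∑' n, h n + ∑' n, h (n + 1)) ≤
      4 / lowerBd τ ^ 2 * (2 / c + 2 / c) := by gcongr
    _ = _ := by ring

lemma rowNorm_rpow_le (τ : ℍ) {c : ℕ} (hc : 0 < c) (d : ℤ) {p : ℝ} (hp : p ∈ Set.Icc (2 : ℝ) 4) :
    rowNorm τ c d ^ (-p) ≤ lowerBd τ ^ (-2 : ℝ) * rowNorm τ c d ^ (-2 : ℝ) :=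
  rpow_neg_le_of_lower_bound (lowerBd_pos τ) (lowerBd_le_one τ) (lowerBd_le_rowNorm τ hc d)
    hp.1 (by linarith [hp.2])

lemma summable_rowNorm (τ : ℍ) {c : ℕ} (hc : 0 < c) {p : ℝ} (hp : p ∈ Set.Icc (2 : ℝ) 4) :
    Summable fun d : ℤ ↦ rowNorm τ c d ^ (-p) :=
  Summable.of_nonneg_of_le (fun d ↦ Real.rpow_nonneg (rowNorm_pos τ hc d).le _)
    (fun d ↦ rowNorm_rpow_le τ hc d hp) ((summable_rowNorm_two τ hc).1.mul_left _)

lemma tsum_rowNorm_le (τ : ℍ) {c : ℕ} (hc : 0 < c) {p : ℝ} (hp : p ∈ Set.Icc (2 : ℝ) 4) :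
    ∑' d : ℤ, rowNorm τ c d ^ (-p) ≤ 16 / lowerBd τ ^ 4 / c := by
  have hr := lowerBd_pos τ
  calc ∑' d : ℤ, rowNorm τ c d ^ (-p)
      ≤ ∑' d : ℤ, lowerBd τ ^ (-2 : ℝ) * rowNorm τ c d ^ (-2 : ℝ) :=
        (summable_rowNorm τ hc hp).tsum_le_tsum (fun d ↦ rowNorm_rpow_le τ hc d hp)
          ((summable_rowNorm_two τ hc).1.mul_left _)
    _ ≤ lowerBd τ ^ (-2 : ℝ) * (16 / lowerBd τ ^ 2 / c) := by
        rw [tsum_mul_left]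
        gcongr
        exact (summable_rowNorm_two τ hc).2
    _ = _ := by
        rw [Real.rpow_neg hr.le, Real.rpow_two]; field_simp

/-- The variation of `t ↦ t^{-p}` between two points at distance at most one. -/
lemma abs_rpow_neg_sub_le {a b p : ℝ} (ha : 0 < a) (hb : 0 < b) (hab : |a - b| ≤ 1)
    (hp : 1 ≤ p) : |a ^ (-p) - b ^ (-p)| ≤ p * (a ^ (-p - 1) + b ^ (-p - 1)) := by
  wlog h : a ≤ b generalizing a b
  · rw [abs_sub_comm, add_comm]
    exact this hb ha (by rwa [abs_sub_comm]) (le_of_not_ge h)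
  have h1 : b - a ≤ 1 := by rw [abs_le] at hab; linarith
  have h2 : b ^ (-p) ≤ a ^ (-p) := Real.rpow_le_rpow_of_nonpos ha h (by linarith)
  rw [abs_of_nonneg (by linarith)]
  have h3 : 1 + p * (a / b - 1) ≤ (a / b) ^ p := by
    have := one_add_mul_self_le_rpow_one_add (s := a / b - 1) (by
      have : 0 ≤ a / b := by positivity
      linarith) hp
    rwa [add_sub_cancel] at this
  have h4 : b ^ (-p) = a ^ (-p) * (a / b) ^ p := by
    rw [Real.div_rpow ha.le hb.le, Real.rpow_neg ha.le, Real.rpow_neg hb.le]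
    have : a ^ p ≠ 0 := (Real.rpow_pos_of_pos ha p).ne'
    field_simp
  have h5 : 1 - a / b ≤ a⁻¹ := by
    rw [← one_div, one_sub_div hb.ne', div_le_div_iff₀ hb ha]
    nlinarith
  have h6 : a ^ (-p - 1) = a ^ (-p) * a⁻¹ := by rw [Real.rpow_sub_one ha.ne', div_eq_mul_inv]
  have h7 : 0 < a ^ (-p) := Real.rpow_pos_of_pos ha _
  have h8 : 0 < b ^ (-p - 1) := Real.rpow_pos_of_pos hb _
  calc a ^ (-p) - b ^ (-p) = a ^ (-p) * (1 - (a / b) ^ p) := by rw [h4]; ring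
    _ ≤ a ^ (-p) * (p * a⁻¹) := by
        refine mul_le_mul_of_nonneg_left ?_ h7.le
        nlinarith
    _ = p * a ^ (-p - 1) := by rw [h6]; ring
    _ ≤ _ := by gcongr; linarith

lemma abs_rowNorm_sub_le (τ : ℍ) (c : ℕ) (d : ℤ) :
    |rowNorm τ c d - rowNorm τ c (d - 1)| ≤ 1 := by
  have := abs_norm_sub_norm_le ((c : ℂ) * τ + d) ((c : ℂ) * τ + (d - 1 : ℤ))
  refine this.trans ?_
  push_cast
  rw [show (c : ℂ) * τ + d - (c * τ + (d - 1)) = 1 by ring, norm_one]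

lemma summable_rowNorm_sub (τ : ℍ) {c : ℕ} (hc : 0 < c) {p : ℝ} (hp : p ∈ Set.Icc (2 : ℝ) 4) :
    Summable fun d : ℤ ↦ |rowNorm τ c d ^ (-p) - rowNorm τ c (d - 1) ^ (-p)| := by
  have h := summable_rowNorm τ hc hp
  exact (h.sub ((Equiv.subRight (1 : ℤ)).summable_iff.2 h)).abs

lemma tsum_rowNorm_sub_le (τ : ℍ) {c : ℕ} (hc : 0 < c) {p : ℝ} (hp : p ∈ Set.Icc (2 : ℝ) 4) :
    ∑' d : ℤ, |rowNorm τ c d ^ (-p) - rowNorm τ c (d - 1) ^ (-p)| ≤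
      128 / lowerBd τ ^ 5 / c ^ 2 := by
  have hr := lowerBd_pos τ
  have hc' : (0 : ℝ) < c := by exact_mod_cast hc
  have h := summable_rowNorm τ hc hp
  have h' := (Equiv.subRight (1 : ℤ)).summable_iff.2 h
  have e' := (Equiv.subRight (1 : ℤ)).tsum_eq fun d ↦ rowNorm τ c d ^ (-p)
  simp only [Function.comp_def, Equiv.subRight_apply] at h' e'
  have hstep : ∀ d : ℤ, rowNorm τ c d ^ (-p - 1) ≤
      (lowerBd τ * c)⁻¹ * rowNorm τ c d ^ (-p) := by
    intro d
    have h0 := rowNorm_pos τ hc d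
    rw [Real.rpow_sub_one h0.ne', div_eq_inv_mul]
    gcongr
    exact lowerBd_mul_natCast_le_rowNorm τ hc d
  have hle : ∀ d : ℤ, |rowNorm τ c d ^ (-p) - rowNorm τ c (d - 1) ^ (-p)| ≤
      4 * (lowerBd τ * c)⁻¹ * (rowNorm τ c d ^ (-p) + rowNorm τ c (d - 1) ^ (-p)) := by
    intro d
    refine (abs_rpow_neg_sub_le (rowNorm_pos τ hc d) (rowNorm_pos τ hc (d - 1))
      (abs_rowNorm_sub_le τ c d) (by linarith [hp.1])).trans ?_
    have a1 := hstep d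
    have a2 := hstep (d - 1)
    have b1 : 0 ≤ rowNorm τ c d ^ (-p - 1) := Real.rpow_nonneg (rowNorm_pos τ hc d).le _
    have b2 : 0 ≤ rowNorm τ c (d - 1) ^ (-p - 1) :=
      Real.rpow_nonneg (rowNorm_pos τ hc (d - 1)).le _
    calc p * (rowNorm τ c d ^ (-p - 1) + rowNorm τ c (d - 1) ^ (-p - 1)) ≤
        4 * ((lowerBd τ * c)⁻¹ * rowNorm τ c d ^ (-p) +
          (lowerBd τ * c)⁻¹ * rowNorm τ c (d - 1) ^ (-p)) := by
          gcongr
          exact hp.2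
      _ = _ := by ring
  refine ((summable_rowNorm_sub τ hc hp).tsum_le_tsum hle ((h.add h').mul_left _)).trans ?_
  rw [tsum_mul_left, h.tsum_add h', e']
  have := tsum_rowNorm_le τ hc hp
  calc 4 * (lowerBd τ * c)⁻¹ * (∑' d : ℤ, rowNorm τ c d ^ (-p) + ∑' d : ℤ, rowNorm τ c d ^ (-p))
      ≤ 4 * (lowerBd τ * c)⁻¹ * (16 / lowerBd τ ^ 4 / c + 16 / lowerBd τ ^ 4 / c) := by gcongr
    _ = _ := by field_simp; norm_num

/-- Summation by parts against a nontrivial unitary character of `ℤ`. -/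
lemma norm_one_sub_mul_norm_tsum_le {ζ : ℂ} (hζ : ‖ζ‖ = 1) {g : ℤ → ℝ} (hg : Summable g) :
    ‖1 - ζ‖ * ‖∑' d : ℤ, ζ ^ d * (g d : ℂ)‖ ≤ ∑' d : ℤ, |g d - g (d - 1)| := by
  have hζ0 : ζ ≠ 0 := norm_pos_iff.1 (by rw [hζ]; norm_num)
  have hn : ∀ d : ℤ, ‖ζ ^ d‖ = 1 := fun d ↦ by rw [norm_zpow, hζ, one_zpow]
  have hs : Summable fun d : ℤ ↦ ζ ^ d * (g d : ℂ) :=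
    Summable.of_norm (by simpa [hn] using hg.abs)
  have hs' : Summable fun d : ℤ ↦ ζ * (ζ ^ (d - 1) * (g (d - 1) : ℂ)) :=
    ((Equiv.subRight (1 : ℤ)).summable_iff.2 hs).mul_left ζ
  have hd : Summable fun d : ℤ ↦ |g d - g (d - 1)| :=
    (hg.sub ((Equiv.subRight (1 : ℤ)).summable_iff.2 hg)).abs
  have e : (1 - ζ) * ∑' d : ℤ, ζ ^ d * (g d : ℂ) =
      ∑' d : ℤ, ζ ^ d * ((g d - g (d - 1) : ℝ) : ℂ) := by
    have e1 := (Equiv.subRight (1 : ℤ)).tsum_eq fun d ↦ ζ ^ d * (g d : ℂ)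
    rw [sub_mul, one_mul]
    nth_rewrite 2 [← e1]
    simp only [Equiv.subRight_apply]
    rw [← tsum_mul_left, ← hs.tsum_sub hs']
    refine tsum_congr fun d ↦ ?_
    rw [← mul_assoc, ← zpow_one_add₀ hζ0, add_sub_cancel]
    push_cast
    ring
  rw [← norm_mul, e]
  refine tsum_of_norm_bounded hd.hasSum fun d ↦ ?_
  rw [norm_mul, hn, one_mul, Complex.norm_real, Real.norm_eq_abs]

section DFT
variable {c : ℕ} [NeZero c]

/-- The bound `|1 - e(n/c)|⁻¹ ≤ c (1/n + 1/(c - n))` for `0 < n < c`, from `sin x ≥ 2x/π`. -/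
lemma norm_one_sub_stdAddChar {n : ZMod c} (hn : n ≠ 0) :
    ‖1 - ZMod.stdAddChar n‖⁻¹ ≤ c * ((n.val : ℝ)⁻¹ + ((c : ℝ) - n.val)⁻¹) := by
  have hcpos : (0 : ℝ) < c := by exact_mod_cast Nat.pos_of_ne_zero (NeZero.ne c)
  have hv0 : (0 : ℝ) < n.val := by
    exact_mod_cast Nat.pos_of_ne_zero fun h ↦ hn ((ZMod.val_eq_zero n).1 h)
  have hv1 : (0 : ℝ) < c - n.val := sub_pos.2 (by exact_mod_cast n.val_lt)
  have e : ZMod.stdAddChar n = Complex.exp (Complex.I * ((2 * Real.pi * n.val / c : ℝ) : ℂ)) := by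
    conv_lhs => rw [← ZMod.natCast_zmod_val n, ← Int.cast_natCast, ZMod.stdAddChar_coe]
    congr 1
    push_cast
    ring
  have hpi := Real.pi_pos
  rw [norm_sub_rev, e, Complex.norm_exp_I_mul_ofReal_sub_one, Real.norm_eq_abs, abs_mul, abs_two,
    show 2 * Real.pi * n.val / c / 2 = Real.pi * n.val / c by ring]
  have hsin : 2 * (min (n.val : ℝ) (c - n.val) / c) ≤ Real.sin (Real.pi * n.val / c) := by
    rcases le_total (n.val : ℝ) (c - n.val) with h | h
    · rw [min_eq_left h]
      have := Real.mul_le_sin (x := Real.pi * n.val / c) (by positivity) (by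
        rw [div_le_div_iff₀ hcpos two_pos]; nlinarith)
      refine le_trans (le_of_eq ?_) this
      field_simp
    · rw [min_eq_right h]
      have := Real.mul_le_sin (x := Real.pi * (c - n.val) / c) (by positivity) (by
        rw [div_le_div_iff₀ hcpos two_pos]; nlinarith)
      rw [← Real.sin_pi_sub (Real.pi * n.val / c)]
      rw [show Real.pi - Real.pi * n.val / c = Real.pi * (c - n.val) / c by field_simp]
      refine le_trans (le_of_eq ?_) this
      field_simp
  have hm : 0 < min (n.val : ℝ) (c - n.val) := lt_min hv0 hv1
  have hm' : (min (n.val : ℝ) (c - n.val))⁻¹ ≤ (n.val : ℝ)⁻¹ + ((c : ℝ) - n.val)⁻¹ := by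
    have := inv_pos.2 hv0
    have := inv_pos.2 hv1
    rcases le_total (n.val : ℝ) (c - n.val) with h | h
    · rw [min_eq_left h]; linarith
    · rw [min_eq_right h]; linarith
  have hle : min (n.val : ℝ) (c - n.val) / c ≤ 2 * |Real.sin (Real.pi * n.val / c)| := by
    have := le_abs_self (Real.sin (Real.pi * n.val / c))
    have : 0 < min (n.val : ℝ) (c - n.val) / c := by positivity
    linarith
  calc (2 * |Real.sin (Real.pi * n.val / c)|)⁻¹ ≤ (min (n.val : ℝ) (c - n.val) / c)⁻¹ := by
        gcongr
    _ = c * (min (n.val : ℝ) (c - n.val))⁻¹ := by rw [inv_div, div_eq_mul_inv]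
    _ ≤ _ := by gcongr

lemma sum_inv_norm_one_sub_le :
    ∑ n : ZMod c, ‖1 - ZMod.stdAddChar n‖⁻¹ ≤ 2 * c * (1 + Real.log c) := by
  have hcpos : (0 : ℝ) < c := by exact_mod_cast Nat.pos_of_ne_zero (NeZero.ne c)
  have hH : ∑ i ∈ Finset.range c, ((i : ℝ) + 1)⁻¹ ≤ 1 + Real.log c := by
    have := harmonic_le_one_add_log c
    rw [harmonic] at this
    push_cast at this
    exact this
  have h1 : ∑ v ∈ Finset.range c, (v : ℝ)⁻¹ ≤ 1 + Real.log c := by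
    refine le_trans ?_ hH
    have a := Finset.sum_range_succ' (fun i : ℕ ↦ (i : ℝ)⁻¹) c
    have b := Finset.sum_range_succ (fun i : ℕ ↦ (i : ℝ)⁻¹) c
    push_cast at a b
    have : (0 : ℝ) ≤ (c : ℝ)⁻¹ := by positivity
    simp at a
    linarith
  have h2 : ∑ v ∈ Finset.range c, ((c : ℝ) - v)⁻¹ ≤ 1 + Real.log c := by
    refine le_trans (le_of_eq ?_) hH
    rw [← Finset.sum_range_reflect]
    refine Finset.sum_congr rfl fun v hv ↦ ?_
    have := Finset.mem_range.1 hv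
    rw [Nat.cast_sub (by omega), Nat.cast_sub (by omega)]
    push_cast
    congr 1
    ring
  have hre : ∑ n : ZMod c, c * ((n.val : ℝ)⁻¹ + ((c : ℝ) - n.val)⁻¹) =
      ∑ v ∈ Finset.range c, c * ((v : ℝ)⁻¹ + ((c : ℝ) - v)⁻¹) := by
    refine Finset.sum_nbij ZMod.val (fun n _ ↦ Finset.mem_range.2 n.val_lt)
      (ZMod.val_injective c).injOn (fun v hv ↦ ?_) fun _ _ ↦ rfl
    exact ⟨(v : ZMod c), by simp, ZMod.val_cast_of_lt (Finset.mem_range.1 hv)⟩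
  calc ∑ n : ZMod c, ‖1 - ZMod.stdAddChar n‖⁻¹
      ≤ ∑ n : ZMod c, c * ((n.val : ℝ)⁻¹ + ((c : ℝ) - n.val)⁻¹) := by
        refine Finset.sum_le_sum fun n _ ↦ ?_
        by_cases hn : n = 0
        -- For `n = 0` the left-hand side is `0⁻¹ = 0`.
        · subst hn
          simp
        · exact norm_one_sub_stdAddChar hn
    _ ≤ _ := by
        rw [hre, ← Finset.mul_sum, Finset.sum_add_distrib]
        nlinarith

/-- The function `d ↦ e(-ν d̄ / c)` on the residues prime to `c`, extended by zero. -/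
def invChar (c : ℕ) [NeZero c] (ν : ℕ) (x : ZMod c) : ℂ :=
  if IsUnit x then ZMod.stdAddChar (-(ν : ZMod c) * x⁻¹) else 0

open scoped ZMod in
lemma dft_invChar (ν : ℕ) (n : ZMod c) : 𝓕 (invChar c ν) n = kloosterman (-n) (-(ν : ZMod c)) := by
  rw [ZMod.dft_apply, kloosterman]
  symm
  refine Fintype.sum_of_injective (fun u : (ZMod c)ˣ ↦ (u : ZMod c)) Units.val_injective _ _
    (fun i hi ↦ ?_) fun u ↦ ?_
  · have : ¬ IsUnit i := fun ⟨u, hu⟩ ↦ hi ⟨u, hu⟩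
    simp [invChar, this]
  · rw [invChar, if_pos u.isUnit, smul_eq_mul, ← AddChar.map_add_eq_mul, ZMod.inv_coe_unit]
    congr 1
    ring

open scoped ZMod in
lemma invChar_eq (ν : ℕ) (x : ZMod c) : invChar c ν x =
    (c : ℂ)⁻¹ * ∑ n : ZMod c, ZMod.stdAddChar (n * x) * kloosterman (-n) (-(ν : ZMod c)) := by
  conv_lhs => rw [← ZMod.dft.symm_apply_apply (invChar c ν), ZMod.invDFT_apply]
  simp only [dft_invChar, smul_eq_mul]

lemma norm_stdAddChar (n : ZMod c) : ‖ZMod.stdAddChar n‖ = 1 := by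
  rw [ZMod.stdAddChar_apply, Circle.norm_coe]

lemma norm_invChar_le (ν : ℕ) (x : ZMod c) : ‖invChar c ν x‖ ≤ 1 := by
  unfold invChar
  split_ifs
  · rw [norm_stdAddChar]
  · simp

lemma norm_tsum_stdAddChar_le (τ : ℍ) {p : ℝ} (hp : p ∈ Set.Icc (2 : ℝ) 4)
    (n : ZMod c) :
    ‖∑' d : ℤ, ZMod.stdAddChar (n * (d : ZMod c)) * ((rowNorm τ c d ^ (-p) : ℝ) : ℂ)‖ ≤
      (if n = 0 then 16 / lowerBd τ ^ 4 / c else 0) +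
        128 / lowerBd τ ^ 5 / c ^ 2 * ‖1 - ZMod.stdAddChar n‖⁻¹ := by
  have hr := lowerBd_pos τ
  have hc := Nat.pos_of_ne_zero (NeZero.ne c)
  have hs := summable_rowNorm τ hc hp
  by_cases hn : n = 0
  · subst hn
    simp only [zero_mul, AddChar.map_zero_eq_one, one_mul, sub_self, norm_zero, inv_zero, mul_zero,
      add_zero, if_true]
    refine le_trans (tsum_of_norm_bounded hs.hasSum fun d ↦ ?_) (tsum_rowNorm_le τ hc hp)
    rw [Complex.norm_real, Real.norm_eq_abs,
      abs_of_nonneg (Real.rpow_nonneg (rowNorm_pos τ hc d).le _)]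
  · have hne : 0 < ‖1 - ZMod.stdAddChar n‖ := by
      rw [norm_pos_iff, sub_ne_zero]
      intro h
      exact hn (ZMod.injective_stdAddChar (by rw [← h, AddChar.map_zero_eq_one]))
    have e : ∀ d : ℤ, ZMod.stdAddChar (n * (d : ZMod c)) = ZMod.stdAddChar n ^ d := fun d ↦ by
      rw [mul_comm, ← zsmul_eq_mul, AddChar.map_zsmul_eq_zpow]
    have := (norm_one_sub_mul_norm_tsum_le (norm_stdAddChar n) hs).trans
      (tsum_rowNorm_sub_le τ hc hp)
    simp only [e]
    rw [mul_comm, ← le_div_iff₀ hne, div_eq_mul_inv] at this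
    rw [if_neg hn, zero_add]
    exact this

/-- The contribution of the row `c` to the main part of the Poincaré series, bounded through its
expansion into Kloosterman sums. -/
lemma norm_tsum_invChar_le {ν : ℕ} (hν : 0 < ν) (τ : ℍ) {p : ℝ} (hp : p ∈ Set.Icc (2 : ℝ) 4) :
    ‖∑' d : ℤ, invChar c ν d * ((rowNorm τ c d ^ (-p) : ℝ) : ℂ)‖ ≤
      1000 * ν / lowerBd τ ^ 5 *
        (c.divisors.card * (c : ℝ) ^ (-(13 / 12) : ℝ) * (2 + Real.log c)) := by
  have hr := lowerBd_pos τ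
  have hr1 := lowerBd_le_one τ
  have hc := Nat.pos_of_ne_zero (NeZero.ne c)
  have hc' : (0 : ℝ) < c := by exact_mod_cast hc
  have hlog : 0 ≤ Real.log c := Real.log_natCast_nonneg c
  set G : ZMod c → ℂ := fun n ↦
    ∑' d : ℤ, ZMod.stdAddChar (n * (d : ZMod c)) * ((rowNorm τ c d ^ (-p) : ℝ) : ℂ) with hG
  have hsum : ∀ n : ZMod c, Summable fun d : ℤ ↦
      ZMod.stdAddChar (n * (d : ZMod c)) * ((rowNorm τ c d ^ (-p) : ℝ) : ℂ) := fun n ↦ by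
    refine Summable.of_norm ?_
    simpa [norm_stdAddChar] using (summable_rowNorm τ hc hp).abs
  have e : ∑' d : ℤ, invChar c ν d * ((rowNorm τ c d ^ (-p) : ℝ) : ℂ) =
      (c : ℂ)⁻¹ * ∑ n : ZMod c, kloosterman (-n) (-(ν : ZMod c)) * G n := by
    have : ∀ d : ℤ, invChar c ν d * ((rowNorm τ c d ^ (-p) : ℝ) : ℂ) = (c : ℂ)⁻¹ *
        ∑ n : ZMod c, kloosterman (-n) (-(ν : ZMod c)) *
          (ZMod.stdAddChar (n * (d : ZMod c)) * ((rowNorm τ c d ^ (-p) : ℝ) : ℂ)) := fun d ↦ by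
      rw [invChar_eq, mul_assoc, Finset.sum_mul]
      congr 1
      exact Finset.sum_congr rfl fun n _ ↦ by ring
    simp only [this]
    rw [tsum_mul_left, Summable.tsum_finsetSum fun n _ ↦ (hsum n).mul_left _]
    simp only [tsum_mul_left, hG]
  set K : ℝ := 3 * ν * c.divisors.card * (c : ℝ) ^ (11 / 12 : ℝ) with hK
  have hK0 : 0 ≤ K := by positivity
  have hGsum : ∑ n : ZMod c, ‖G n‖ ≤ 256 / lowerBd τ ^ 5 / c * (2 + Real.log c) := by
    calc ∑ n : ZMod c, ‖G n‖ ≤ ∑ n : ZMod c, ((if n = 0 then 16 / lowerBd τ ^ 4 / c else 0) +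
          128 / lowerBd τ ^ 5 / c ^ 2 * ‖1 - ZMod.stdAddChar n‖⁻¹) :=
          Finset.sum_le_sum fun n _ ↦ norm_tsum_stdAddChar_le τ hp n
      _ ≤ 16 / lowerBd τ ^ 4 / c + 128 / lowerBd τ ^ 5 / c ^ 2 * (2 * c * (1 + Real.log c)) := by
          rw [Finset.sum_add_distrib, ← Finset.mul_sum, Finset.sum_ite_eq' Finset.univ 0,
            if_pos (Finset.mem_univ _)]
          gcongr
          exact sum_inv_norm_one_sub_le
      _ ≤ 256 / lowerBd τ ^ 5 / c + 128 / lowerBd τ ^ 5 / c ^ 2 * (2 * c * (1 + Real.log c)) := by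
          have : 16 / lowerBd τ ^ 4 ≤ 256 / lowerBd τ ^ 5 :=
            div_le_div₀ (by norm_num) (by norm_num) (by positivity)
              (pow_le_pow_of_le_one hr.le hr1 (by norm_num))
          gcongr
      _ = _ := by field_simp; ring
  rw [e, norm_mul, norm_inv, Complex.norm_natCast]
  calc (c : ℝ)⁻¹ * ‖∑ n : ZMod c, kloosterman (-n) (-(ν : ZMod c)) * G n‖
      ≤ (c : ℝ)⁻¹ * ∑ n : ZMod c, K * ‖G n‖ := by
        gcongr
        refine norm_sum_le_of_le _ fun n _ ↦ ?_
        rw [norm_mul]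
        gcongr
        exact norm_kloosterman_le hν _ (Or.inr rfl)
    _ ≤ (c : ℝ)⁻¹ * (K * (256 / lowerBd τ ^ 5 / c * (2 + Real.log c))) := by
        rw [← Finset.mul_sum]
        gcongr
    _ = 768 * ν / lowerBd τ ^ 5 *
        (c.divisors.card * (c : ℝ) ^ (-(13 / 12) : ℝ) * (2 + Real.log c)) := by
        have : (c : ℝ) ^ (-(13 / 12) : ℝ) = (c : ℝ) ^ (11 / 12 : ℝ) * (c : ℝ)⁻¹ * (c : ℝ)⁻¹ := by
          rw [← Real.rpow_neg_one, ← Real.rpow_add hc', ← Real.rpow_add hc']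
          norm_num
        rw [this, hK]
        field_simp
        ring
    _ ≤ _ := by
        gcongr
        norm_num

end DFT

open scoped ArithmeticFunction.zeta in
lemma summable_card_divisors_mul_rpow {x : ℝ} (hx : 1 < x) :
    Summable fun n : ℕ ↦ (n.divisors.card : ℝ) * (n : ℝ) ^ (-x) := by
  have hz : LSeriesSummable (fun n ↦ ((ζ : ArithmeticFunction ℂ) n)) x := by
    have := ArithmeticFunction.LSeriesSummable_zeta_iff (s := (x : ℂ)).2 (by simpa using hx)
    exact this
  have h := ArithmeticFunction.LSeriesSummable_mul hz hz
  refine h.norm.congr fun n ↦ ?_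
  rcases Nat.eq_zero_or_pos n with rfl | hn
  · simp
  rw [LSeries.norm_term_eq, if_neg hn.ne', ArithmeticFunction.coe_zeta_mul_apply,
    Complex.ofReal_re, Real.rpow_neg (Nat.cast_nonneg n), div_eq_mul_inv]
  congr 1
  rw [Finset.sum_congr rfl (g := fun _ ↦ (1 : ℂ)) fun d hd ↦ ?_]
  · simp
  · simp [(Nat.pos_of_mem_divisors hd).ne']

/-- The saving in Kloosterman's bound makes the rows summable at `s = 1`; the divisor function is
absorbed by the convergence of the Dirichlet series of `ζ(s)²` at `s = 25/24`. -/
lemma summable_row_bound : Summable fun c : ℕ ↦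
    (c.divisors.card : ℝ) * (c : ℝ) ^ (-(13 / 12) : ℝ) * (2 + Real.log c) := by
  refine Summable.of_nonneg_of_le (fun c ↦ ?_) (fun c ↦ ?_)
    ((summable_card_divisors_mul_rpow (x := 25 / 24) (by norm_num)).mul_left 26)
  · have := Real.log_natCast_nonneg c
    positivity
  · rcases Nat.eq_zero_or_pos c with rfl | hc
    · simp
    have hc' : (1 : ℝ) ≤ c := by exact_mod_cast hc
    have h1 : Real.log c ≤ 24 * (c : ℝ) ^ (1 / 24 : ℝ) := by
      have := Real.log_le_rpow_div (x := c) (by linarith) (ε := 1 / 24) (by norm_num)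
      linarith
    have h2 : 1 ≤ (c : ℝ) ^ (1 / 24 : ℝ) := Real.one_le_rpow hc' (by norm_num)
    calc (c.divisors.card : ℝ) * (c : ℝ) ^ (-(13 / 12) : ℝ) * (2 + Real.log c)
        ≤ (c.divisors.card : ℝ) * (c : ℝ) ^ (-(13 / 12) : ℝ) * (26 * (c : ℝ) ^ (1 / 24 : ℝ)) := by
          gcongr
          linarith
      _ = 26 * ((c.divisors.card : ℝ) *
          ((c : ℝ) ^ (-(13 / 12) : ℝ) * (c : ℝ) ^ (1 / 24 : ℝ))) := by ring
      _ = _ := by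
          rw [← Real.rpow_add (by linarith)]
          norm_num

/-! ### The limit in weight zero -/

/-- The main part of `(φ_{ν,s}|_0 A)(τ)`, up to the factor `(4πνy)^s`: the seed is replaced by its
leading term as `y → 0`, and `Re (Aτ)` by its limit `a/c`. -/
def mainTerm (ν : ℕ) (τ : ℍ) (s : ℝ) (A : Matrix (Fin 2) (Fin 2) ℤ) : ℂ :=
  if A 1 0 = 0 then 0 else
    Complex.exp (-2 * Real.pi * Complex.I * ν * ((A 0 0 : ℝ) / (A 1 0 : ℝ) : ℝ)) *
      ((‖autj A τ‖ ^ (-(2 * s)) : ℝ) : ℂ)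

lemma norm_mainTerm_le (ν : ℕ) (τ : ℍ) (s : ℝ) (A : Matrix (Fin 2) (Fin 2) ℤ) :
    ‖mainTerm ν τ s A‖ ≤ ‖autj A τ‖ ^ (-(2 * s)) := by
  have h : 0 ≤ ‖autj A τ‖ ^ (-(2 * s)) := by positivity
  unfold mainTerm
  split_ifs
  · simpa using h
  · rw [norm_mul, norm_exp_re, one_mul, Complex.norm_real, Real.norm_eq_abs, abs_of_nonneg h]

lemma norm_exp_re_sub_le (ν : ℕ) (x y : ℝ) :
    ‖Complex.exp (-2 * Real.pi * Complex.I * ν * x) -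
      Complex.exp (-2 * Real.pi * Complex.I * ν * y)‖ ≤ 2 * Real.pi * ν * |x - y| := by
  have e : Complex.exp (-2 * Real.pi * Complex.I * ν * x) -
      Complex.exp (-2 * Real.pi * Complex.I * ν * y) =
      Complex.exp (-2 * Real.pi * Complex.I * ν * y) *
        (Complex.exp (Complex.I * ((-2 * Real.pi * ν * (x - y) : ℝ) : ℂ)) - 1) := by
    rw [mul_sub, ← Complex.exp_add, mul_one]
    congr 2
    push_cast
    ring
  rw [e, norm_mul, norm_exp_re, one_mul]
  refine Real.norm_exp_I_mul_ofReal_sub_one_le.trans (le_of_eq ?_)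
  rw [Real.norm_eq_abs, abs_mul, abs_mul, abs_mul, abs_neg, abs_two, abs_of_pos Real.pi_pos,
    Nat.abs_cast]

lemma abs_re_mob_sub_le {A : Matrix (Fin 2) (Fin 2) ℤ} (hA : A.det = 1) (hc : A 1 0 ≠ 0) (τ : ℍ) :
    |(mob A τ).re - (A 0 0 : ℝ) / (A 1 0 : ℝ)| ≤ ‖autj A τ‖⁻¹ := by
  have hdet : A.det ≠ 0 := by rw [hA]; norm_num
  have hj := autj_ne_zero hdet τ
  have hc' : (A 1 0 : ℂ) ≠ 0 := by exact_mod_cast hc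
  have e : (mob A τ : ℂ) - ((A 0 0 : ℝ) / (A 1 0 : ℝ) : ℝ) = -((A 1 0 : ℂ) * autj A τ)⁻¹ := by
    have hd : (A 0 0 : ℂ) * A 1 1 - A 0 1 * A 1 0 = 1 := by
      rw [Matrix.det_fin_two] at hA; exact_mod_cast hA
    rw [coe_mob (by rw [hA]; norm_num)]
    push_cast
    field_simp
    simp only [autj]
    linear_combination -hd
  have h1 := Complex.abs_re_le_norm ((mob A τ : ℂ) - ((A 0 0 : ℝ) / (A 1 0 : ℝ) : ℝ))
  rw [Complex.sub_re, Complex.ofReal_re, coe_re] at h1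
  refine h1.trans ?_
  rw [e, norm_neg, norm_inv, norm_mul]
  have h2 : (1 : ℝ) ≤ ‖(A 1 0 : ℂ)‖ := by
    rw [Complex.norm_intCast]; exact_mod_cast Int.one_le_abs hc
  have h3 : 0 < ‖autj A τ‖ := norm_pos_iff.2 hj
  gcongr
  exact le_mul_of_one_le_left h3.le h2

lemma abs_exp_mul_kummer_sub_one_le {s w : ℝ} (hs : s ∈ Set.Icc (1 : ℝ) 2) (hw : 0 ≤ w) :
    |Real.exp (-w / 2) * kummer s (2 * s) w - 1| ≤ 3 * w * Real.exp (2 * w) := by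
  have ha : |s| ≤ 2 := by rw [abs_of_nonneg (by linarith [hs.1])]; exact hs.2
  have h1 := abs_kummer_le one_le_two ha (by linarith [hs.1] : 1 ≤ 2 * s) hw
  have h2 := abs_kummer_sub_one_le one_le_two ha (by linarith [hs.1] : 1 ≤ 2 * s) hw
  have h3 : |Real.exp (-w / 2) - 1| ≤ w / 2 := by
    rw [abs_sub_comm, abs_of_nonneg (sub_nonneg.2 (Real.exp_le_one_iff.2 (by linarith)))]
    linarith [Real.add_one_le_exp (-w / 2)]
  have h4 : Real.exp (2 * w) - 1 ≤ 2 * w * Real.exp (2 * w) := by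
    have h5 := Real.add_one_le_exp (-(2 * w))
    have h6 : Real.exp (-(2 * w)) * Real.exp (2 * w) = 1 := by
      rw [← Real.exp_add, neg_add_cancel, Real.exp_zero]
    nlinarith [Real.exp_pos (2 * w)]
  calc |Real.exp (-w / 2) * kummer s (2 * s) w - 1|
      = |(Real.exp (-w / 2) - 1) * kummer s (2 * s) w + (kummer s (2 * s) w - 1)| := by
        congr 1; ring
    _ ≤ |Real.exp (-w / 2) - 1| * |kummer s (2 * s) w| + |kummer s (2 * s) w - 1| := by
        rw [← abs_mul]; exact abs_add_le _ _
    _ ≤ w / 2 * Real.exp (2 * w) + 2 * w * Real.exp (2 * w) := by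
        have := h2.trans h4
        gcongr
    _ ≤ _ := by nlinarith [mul_nonneg hw (Real.exp_pos (2 * w)).le]

/-- In weight zero, the summand differs from its main part by an amount that is summable uniformly
up to `s = 1`. -/
lemma exists_norm_slash_seed_sub_mainTerm_le {ν : ℕ} (hν : 0 < ν) (τ : ℍ) :
    ∃ C : ℝ, ∀ s ∈ Set.Icc (1 : ℝ) 2, ∀ A : Matrix (Fin 2) (Fin 2) ℤ, A.det = 1 →
      ‖slash 0 A (seed 0 ν s) τ - (((4 * Real.pi * ν * τ.im) ^ s : ℝ) : ℂ) * mainTerm ν τ s A‖ ≤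
        C * ‖autj A τ‖ ^ (-3 : ℝ) := by
  obtain ⟨C₁, hC₁⟩ := exists_norm_slash_seed_le 0 le_rfl hν τ le_rfl
  set w₀ : ℝ := 4 * Real.pi * ν * τ.im with hw₀
  have hy := τ.im_pos
  have hr := lowerBd_pos τ
  have hw₀p : 0 < w₀ := by positivity
  set C₂ : ℝ := (1 + w₀) ^ 2 * (3 * (w₀ * (lowerBd τ)⁻¹) * Real.exp (2 * (w₀ / lowerBd τ ^ 2)) +
    2 * Real.pi * ν) * lowerBd τ ^ (-2 : ℝ) with hC₂
  refine ⟨max C₁ C₂, fun s hs A hA ↦ ?_⟩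
  have hdet : A.det ≠ 0 := by rw [hA]; norm_num
  have ha := lowerBd_le_autj τ hdet
  have ha0 : 0 < ‖autj A τ‖ := hr.trans_le ha
  by_cases hc : A 1 0 = 0
  · have h1 := hC₁ s ⟨hs.1, by linarith [hs.2]⟩ A hA
    have h2 : ‖autj A τ‖ = 1 := by
      have h3 : A 1 1 * A 0 0 = 1 := by
        rw [Matrix.det_fin_two, hc] at hA; linarith
      simp only [autj, hc, Int.cast_zero, zero_mul, zero_add, Complex.norm_intCast]
      exact_mod_cast Int.isUnit_iff_abs_eq.1 (IsUnit.of_mul_eq_one _ h3)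
    rw [h2, Real.one_rpow, mul_one] at h1 ⊢
    simp only [mainTerm, if_pos hc, mul_zero, sub_zero]
    exact h1.trans (le_max_left _ _)
  · set a := ‖autj A τ‖ with ha'
    set w := w₀ / a ^ 2 with hw
    have hwp : 0 < w := by positivity
    have hwe : w = 4 * Real.pi * ν * (mob A τ).im := by
      rw [hw, im_mob (by rw [hA]; norm_num), hA]; push_cast; ring
    have hws : w ^ s = w₀ ^ s * a ^ (-(2 * s)) := by
      rw [hw, Real.div_rpow hw₀p.le (by positivity), ← Real.rpow_natCast, ← Real.rpow_mul ha0.le,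
        Real.rpow_neg ha0.le, div_eq_mul_inv]
      push_cast; rfl
    have e : slash 0 A (seed 0 ν s) τ - ((w₀ ^ s : ℝ) : ℂ) * mainTerm ν τ s A =
        ((w₀ ^ s * a ^ (-(2 * s)) : ℝ) : ℂ) *
          (((Real.exp (-w / 2) * kummer s (2 * s) w - 1 : ℝ) : ℂ) *
              Complex.exp (-2 * Real.pi * Complex.I * ν * (mob A τ).re) +
            (Complex.exp (-2 * Real.pi * Complex.I * ν * (mob A τ).re) -
              Complex.exp (-2 * Real.pi * Complex.I * ν *
                ((A 0 0 : ℝ) / (A 1 0 : ℝ) : ℝ)))) := by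
      have hG : Real.Gamma 2 = 1 := by
        rw [← one_add_one_eq_two, Real.Gamma_add_one one_ne_zero, Real.Gamma_one, mul_one]
      rw [slash_eq, seed_eq 0 ν s _ hwe, hws, mainTerm, if_neg hc, hA]
      simp only [Int.cast_zero, neg_zero, zero_div, Real.rpow_zero, zpow_zero, sub_zero, hG,
        add_zero]
      push_cast
      ring
    rw [e, norm_mul, Complex.norm_real, Real.norm_eq_abs, abs_of_nonneg (by positivity)]
    have hwle : w ≤ w₀ / lowerBd τ ^ 2 := by rw [hw]; gcongr
    have hwle2 : w ≤ w₀ * (lowerBd τ)⁻¹ * a⁻¹ := by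
      rw [hw, pow_two, div_eq_mul_inv, mul_inv, ← mul_assoc]
      gcongr
    have h1 : ‖((Real.exp (-w / 2) * kummer s (2 * s) w - 1 : ℝ) : ℂ) *
              Complex.exp (-2 * Real.pi * Complex.I * ν * (mob A τ).re) +
            (Complex.exp (-2 * Real.pi * Complex.I * ν * (mob A τ).re) -
              Complex.exp (-2 * Real.pi * Complex.I * ν *
                ((A 0 0 : ℝ) / (A 1 0 : ℝ) : ℝ)))‖ ≤
        (3 * (w₀ * (lowerBd τ)⁻¹) * Real.exp (2 * (w₀ / lowerBd τ ^ 2)) +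
          2 * Real.pi * ν) * a⁻¹ := by
      refine (norm_add_le _ _).trans ?_
      rw [norm_mul, norm_exp_re, mul_one, Complex.norm_real, Real.norm_eq_abs, add_mul]
      refine add_le_add ?_ ?_
      · calc _ ≤ 3 * w * Real.exp (2 * w) := abs_exp_mul_kummer_sub_one_le hs hwp.le
          _ ≤ 3 * (w₀ * (lowerBd τ)⁻¹ * a⁻¹) * Real.exp (2 * (w₀ / lowerBd τ ^ 2)) := by gcongr
          _ = _ := by ring
      · refine (norm_exp_re_sub_le _ _ _).trans ?_
        gcongr
        exact abs_re_mob_sub_le hA hc τ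
    have h2 : w₀ ^ s ≤ (1 + w₀) ^ 2 := by
      calc w₀ ^ s ≤ (1 + w₀) ^ s := Real.rpow_le_rpow hw₀p.le (by linarith) (by linarith [hs.1])
        _ ≤ (1 + w₀) ^ (2 : ℝ) := Real.rpow_le_rpow_of_exponent_le (by linarith) hs.2
        _ = _ := Real.rpow_two _
    have h3 : a ^ (-(2 * s)) * a⁻¹ ≤ lowerBd τ ^ (-2 : ℝ) * a ^ (-3 : ℝ) := by
      rw [← Real.rpow_neg_one, ← Real.rpow_add ha0, ← neg_add]
      exact rpow_neg_le_of_lower_bound hr (lowerBd_le_one τ) ha (by linarith [hs.1])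
        (by linarith [hs.2])
    calc _ ≤ w₀ ^ s * a ^ (-(2 * s)) * ((3 * (w₀ * (lowerBd τ)⁻¹) *
          Real.exp (2 * (w₀ / lowerBd τ ^ 2)) + 2 * Real.pi * ν) * a⁻¹) := by gcongr
      _ = w₀ ^ s * (3 * (w₀ * (lowerBd τ)⁻¹) *
          Real.exp (2 * (w₀ / lowerBd τ ^ 2)) + 2 * Real.pi * ν) * (a ^ (-(2 * s)) * a⁻¹) := by
          ring
      _ ≤ (1 + w₀) ^ 2 * (3 * (w₀ * (lowerBd τ)⁻¹) *
          Real.exp (2 * (w₀ / lowerBd τ ^ 2)) + 2 * Real.pi * ν) *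
            (lowerBd τ ^ (-2 : ℝ) * a ^ (-3 : ℝ)) := by gcongr
      _ = C₂ * a ^ (-3 : ℝ) := by rw [hC₂]; ring
      _ ≤ _ := by gcongr; exact le_max_right _ _

/-- The summand of the main part at the bottom row `(c, d) = (n + 1, d)`, extended by zero to all
pairs `(n, d)`. -/
def rowTerm (N ν : ℕ) (τ : ℍ) (s : ℝ) (p : ℕ × ℤ) : ℂ :=
  if N ∣ p.1 + 1 then
    invChar (p.1 + 1) ν p.2 * ((rowNorm τ (p.1 + 1) p.2 ^ (-(2 * s)) : ℝ) : ℂ) else 0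

lemma dvd_rep {N : ℕ} (γ : Cosets N) : (N : ℤ) ∣ rep γ 1 0 :=
  (ZMod.intCast_zmod_eq_zero_iff_dvd _ _).1 (CongruenceSubgroup.Gamma0_mem.1 γ.out.2)

lemma sign_mul_sign {c : ℤ} (hc : c ≠ 0) : c.sign * c.sign = 1 := by
  rw [← Int.sign_mul, Int.sign_eq_one_of_pos (mul_self_pos.2 hc)]

lemma invChar_intCast (m : ℕ) [NeZero m] (ν : ℕ) {x y : ℤ} (h : ((x * y : ℤ) : ZMod m) = 1) :
    invChar m ν x = Complex.exp (-2 * Real.pi * Complex.I * ν * ((y : ℝ) / (m : ℝ) : ℝ)) := by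
  rw [Int.cast_mul] at h
  have hu : IsUnit (x : ZMod m) := IsUnit.of_mul_eq_one _ h
  have hinv : (x : ZMod m)⁻¹ = (y : ZMod m) := by
    obtain ⟨u, hu⟩ := hu
    rw [← hu] at h ⊢
    rw [ZMod.inv_coe_unit]
    exact (Units.eq_inv_of_mul_eq_one_right (by rwa [mul_comm])).symm
  rw [invChar, if_pos hu, hinv, show -(ν : ZMod m) * (y : ZMod m) =
    ((-(ν * y) : ℤ) : ZMod m) by push_cast; ring, ZMod.stdAddChar_coe]
  congr 1
  push_cast
  ring

lemma rowTerm_eq_mainTerm {N ν : ℕ} (τ : ℍ) (s : ℝ) {A : Matrix (Fin 2) (Fin 2) ℤ}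
    (hA : A.det = 1) (hN : (N : ℤ) ∣ A 1 0) (hc : A 1 0 ≠ 0) :
    rowTerm N ν τ s ((A 1 0).natAbs - 1, (A 1 0).sign * A 1 1) = mainTerm ν τ s A := by
  obtain ⟨n, hn⟩ : ∃ n, (A 1 0).natAbs = n + 1 :=
    Nat.exists_eq_succ_of_ne_zero (Int.natAbs_ne_zero.2 hc)
  set σ := (A 1 0).sign with hσ
  have hcs : A 1 0 = σ * ((n + 1 : ℕ) : ℤ) := by
    rw [← hn, hσ, Int.sign_mul_natAbs]
  have hσσ : σ * σ = 1 := by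
    exact sign_mul_sign hc
  have hσσ' : (σ : ℂ) * (σ : ℂ) = 1 := by exact_mod_cast hσσ
  have hNn : N ∣ n + 1 := by
    rw [← hn]; exact Int.natCast_dvd.1 hN
  rw [hn, Nat.add_sub_cancel]
  simp only [rowTerm, if_pos hNn, mainTerm, if_neg hc]
  have hnorm : rowNorm τ (n + 1) (σ * A 1 1) = ‖autj A τ‖ := by
    have : ((n + 1 : ℕ) : ℂ) * τ + ((σ * A 1 1 : ℤ) : ℂ) = σ * autj A τ := by
      rw [autj, hcs]
      push_cast
      linear_combination -((n : ℂ) + 1) * τ * hσσ'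
    rw [rowNorm, this, norm_mul, Complex.norm_intCast]
    have : |(σ : ℝ)| = 1 := by
      exact_mod_cast Int.isUnit_iff_abs_eq.1 (IsUnit.of_mul_eq_one _ hσσ)
    rw [this, one_mul]
  have h1 : (σ * A 1 1) * (σ * A 0 0) = 1 + A 0 1 * σ * ((n + 1 : ℕ) : ℤ) := by
    rw [Matrix.det_fin_two] at hA
    linear_combination (A 1 1 * A 0 0) * hσσ + hA + A 0 1 * hcs
  have hchar : invChar (n + 1) ν ((σ * A 1 1 : ℤ) : ZMod (n + 1)) = Complex.exp
      (-2 * Real.pi * Complex.I * ν * ((A 0 0 : ℝ) / (A 1 0 : ℝ) : ℝ)) := by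
    rw [invChar_intCast (n + 1) ν (y := σ * A 0 0) (by
      rw [h1, Int.cast_add, Int.cast_mul, Int.cast_natCast, ZMod.natCast_self, mul_zero, add_zero,
        Int.cast_one]), hcs]
    congr 2
    push_cast
    have hn0 : (n : ℂ) + 1 ≠ 0 := by exact_mod_cast Nat.succ_ne_zero n
    have hσ0 : (σ : ℂ) ≠ 0 := left_ne_zero_of_mul_eq_one hσσ'
    field_simp
    linear_combination ((A 0 0 : ℂ)) * hσσ'
  rw [hnorm, hchar]

/-- Coprime pairs that are proportional agree up to sign. -/
lemma natAbs_eq_and_sign_mul_eq {x y c d n e : ℤ} (h : x * d - y * c = 1)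
    (hne : ∃ u v : ℤ, u * e - v * n = 1) (hn : 0 < n) (hp : c * e = d * n) :
    (c.natAbs : ℤ) = n ∧ c.sign * d = e := by
  obtain ⟨u, v, hne⟩ := hne
  have h1 : n ∣ c := ⟨u * d - v * c, by linear_combination -c * hne + u * hp⟩
  have h2 : c ∣ n := ⟨x * e - y * n, by linear_combination -n * h - x * hp⟩
  have h3 : (c.natAbs : ℤ) = n := by
    have := Int.natAbs_eq_of_dvd_dvd h1 h2
    rw [← this]; exact Int.natAbs_of_nonneg hn.le
  refine ⟨h3, ?_⟩
  have hc : c ≠ 0 := by rintro rfl; simp at h3; omega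
  have h4 : c.sign * n = c := by rw [← h3, Int.sign_mul_natAbs]
  have h5 := sign_mul_sign hc
  have : n * (c.sign * d) = n * e := by
    linear_combination (-c.sign) * hp + (c.sign * e) * (-h4) + (n * e) * h5
  exact mul_left_cancel₀ hn.ne' this

/-- Rearrangement of the main part according to the rows `c > 0`. -/
lemma hasSum_rowTerm (N ν : ℕ) (τ : ℍ) {s : ℝ} (hs : 1 < s) :
    HasSum (rowTerm N ν τ s) (∑' γ : Cosets N, mainTerm ν τ s (rep γ)) := by
  have hsum : Summable fun γ : Cosets N ↦ mainTerm ν τ s (rep γ) :=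
    Summable.of_norm_bounded (summable_norm_autj_rpow N τ (by linarith : 2 < 2 * s))
      fun γ ↦ norm_mainTerm_le ν τ s _
  have hne : ∀ γ : Function.support fun γ : Cosets N ↦ mainTerm ν τ s (rep γ),
      rep (γ : Cosets N) 1 0 ≠ 0 := by
    rintro ⟨γ, hγ⟩ h
    exact hγ (by simp [mainTerm, h])
  refine (hasSum_iff_hasSum_of_ne_zero_bij
    (fun γ : Function.support fun γ : Cosets N ↦ mainTerm ν τ s (rep γ) ↦
      ((rep (γ : Cosets N) 1 0).natAbs - 1,
        (rep (γ : Cosets N) 1 0).sign * rep (γ : Cosets N) 1 1)) ?_ ?_ ?_).2 hsum.hasSum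
  · intro γ δ h
    have hγ := hne γ
    have hδ := hne δ
    apply Subtype.ext
    simp only [Prod.mk.injEq] at h
    rw [coset_eq_iff]
    have h1 : (rep (γ : Cosets N) 1 0).natAbs = (rep (δ : Cosets N) 1 0).natAbs := by omega
    have h2 := h.2
    generalize rep (γ : Cosets N) 1 0 = c at *
    generalize rep (δ : Cosets N) 1 0 = c' at *
    generalize rep (γ : Cosets N) 1 1 = d at *
    generalize rep (δ : Cosets N) 1 1 = d' at *
    have e1 : c.sign * c'.natAbs = c := by rw [← h1]; exact Int.sign_mul_natAbs c
    have e2 := Int.sign_mul_natAbs c'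
    have e3 : d = c.sign * (c'.sign * d') := by
      linear_combination c.sign * h2 - d * sign_mul_sign hγ
    rw [e3]
    nth_rewrite 1 [← e2]
    nth_rewrite 2 [← e1]
    linear_combination (c.sign * d' * c'.natAbs) * sign_mul_sign hδ
  · rintro ⟨n, e⟩ hp
    have hN : N ∣ n + 1 := by
      by_contra h
      exact hp (by simp [rowTerm, h])
    have hu : IsUnit ((e : ℤ) : ZMod (n + 1)) := by
      by_contra h
      exact hp (by simp [rowTerm, invChar, h])
    have hco : IsCoprime e ((n + 1 : ℕ) : ℤ) :=
      ((ZMod.coe_int_isUnit_iff_isCoprime e (n + 1)).1 hu).symm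
    obtain ⟨a, b, hab⟩ := hco
    let A : SL(2, ℤ) := ⟨!![a, -b; ((n + 1 : ℕ) : ℤ), e], by rw [Matrix.det_fin_two_of]; linarith⟩
    have hA : A ∈ CongruenceSubgroup.Gamma0 N := by
      rw [CongruenceSubgroup.Gamma0_mem]
      exact (ZMod.intCast_zmod_eq_zero_iff_dvd ((n + 1 : ℕ) : ℤ) N).2 (by exact_mod_cast hN)
    let γ : Cosets N := Quotient.mk _ ⟨A, hA⟩
    have h1 : rep γ 1 0 * e = rep γ 1 1 * ((n + 1 : ℕ) : ℤ) := by
      have := (coset_mk_eq_iff ⟨A, hA⟩ γ.out).1 (Quotient.out_eq γ).symm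
      exact this
    have hdet := det_rep γ
    rw [Matrix.det_fin_two] at hdet
    obtain ⟨h2, h3⟩ := natAbs_eq_and_sign_mul_eq hdet ⟨a, -b, by linarith⟩
      (by positivity : (0 : ℤ) < ((n + 1 : ℕ) : ℤ)) h1
    have hn : (rep γ 1 0).natAbs = n + 1 := by exact_mod_cast h2
    have hc : rep γ 1 0 ≠ 0 := by rw [← Int.natAbs_ne_zero, hn]; omega
    have hpair : ((rep γ 1 0).natAbs - 1, (rep γ 1 0).sign * rep γ 1 1) = (n, e) := by
      rw [hn, h3, Nat.add_sub_cancel]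
    refine ⟨⟨γ, ?_⟩, hpair⟩
    have := rowTerm_eq_mainTerm (N := N) (ν := ν) τ s (det_rep γ) (dvd_rep γ) hc
    rw [hpair] at this
    rw [Function.mem_support, ← this]
    exact hp
  · intro γ
    exact rowTerm_eq_mainTerm τ s (det_rep _) (dvd_rep _) (hne γ)

/-- The main part converges only conditionally at `s = 1`: the rows are summed first, and the
resulting sum over `c` is dominated by `norm_tsum_invChar_le`. -/
lemma exists_tendsto_tsum_mainTerm (N : ℕ) {ν : ℕ} (hν : 0 < ν) (τ : ℍ) :
    ∃ L : ℂ, Tendsto (fun s ↦ ∑' γ : Cosets N, mainTerm ν τ s (rep γ)) (𝓝[>] 1) (𝓝 L) := by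
  have hsub : Set.Ioc (1 : ℝ) 2 ∈ 𝓝[>] (1 : ℝ) := Ioc_mem_nhdsGT (by norm_num)
  have hIcc : ∀ s ∈ Set.Icc (1 : ℝ) 2, 2 * s ∈ Set.Icc (2 : ℝ) 4 := fun s hs ↦
    ⟨by linarith [hs.1], by linarith [hs.2]⟩
  have e : (fun s ↦ ∑' n : ℕ, ∑' d : ℤ, rowTerm N ν τ s (n, d)) =ᶠ[𝓝[>] 1]
      fun s ↦ ∑' γ : Cosets N, mainTerm ν τ s (rep γ) := by
    filter_upwards [hsub] with s hs
    have h := hasSum_rowTerm N ν τ hs.1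
    rw [← h.tsum_eq, h.summable.tsum_prod]
  refine ⟨∑' n : ℕ, ∑' d : ℤ, rowTerm N ν τ 1 (n, d), Tendsto.congr' e ?_⟩
  have hb := (summable_nat_add_iff 1).2 summable_row_bound
  refine tendsto_tsum_of_dominated_convergence (hb.mul_left (1000 * ν / lowerBd τ ^ 5))
    (fun n ↦ ?_) ?_
  · refine tendsto_tsum_of_dominated_convergence
      (bound := fun d : ℤ ↦ lowerBd τ ^ (-2 : ℝ) * rowNorm τ (n + 1) d ^ (-2 : ℝ))
      ((summable_rowNorm_two τ n.succ_pos).1.mul_left _) (fun d ↦ ?_) ?_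
    · have hpos := rowNorm_pos τ n.succ_pos d
      have hcont : Continuous fun s ↦ rowTerm N ν τ s (n, d) := by
        unfold rowTerm
        split_ifs
        · refine continuous_const.mul (Complex.continuous_ofReal.comp ?_)
          exact (Real.continuous_const_rpow hpos.ne').comp (by fun_prop)
        · exact continuous_const
      exact (hcont.tendsto 1).mono_left nhdsWithin_le_nhds
    · filter_upwards [hsub] with s hs d
      have hpos := rowNorm_pos τ n.succ_pos d
      have h := rowNorm_rpow_le τ n.succ_pos d (hIcc s ⟨hs.1.le, hs.2⟩)
      have h0 : 0 ≤ rowNorm τ (n + 1) d ^ (-(2 * s)) := Real.rpow_nonneg hpos.le _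
      unfold rowTerm
      split_ifs
      · rw [norm_mul, Complex.norm_real, Real.norm_eq_abs, abs_of_nonneg h0]
        exact (mul_le_of_le_one_left h0 (norm_invChar_le ν _)).trans h
      · rw [norm_zero]
        exact h0.trans h
  · filter_upwards [hsub] with s hs n
    by_cases hN : N ∣ n + 1
    · simp only [rowTerm, if_pos hN]
      exact norm_tsum_invChar_le hν τ (hIcc s ⟨hs.1.le, hs.2⟩)
    · simp only [rowTerm, if_neg hN, tsum_zero, norm_zero]
      have := lowerBd_pos τ
      have := Real.log_natCast_nonneg (n + 1)
      positivity

/-- In weight zero the series extends continuously to the boundary point `s = 1`. -/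
lemma exists_tendsto_series_zero (N : ℕ) {ν : ℕ} (hν : 0 < ν) (τ : ℍ) :
    ∃ L : ℂ, Tendsto (series N 0 ν τ) (𝓝[>] 1) (𝓝 L) := by
  obtain ⟨L, hL⟩ := exists_tendsto_tsum_mainTerm N hν τ
  obtain ⟨C, hC⟩ := exists_norm_slash_seed_sub_mainTerm_le hν τ
  have hsub : Set.Ioc (1 : ℝ) 2 ∈ 𝓝[>] (1 : ℝ) := Ioc_mem_nhdsGT (by norm_num)
  set w₀ : ℝ := 4 * Real.pi * ν * τ.im with hw₀
  have hy := τ.im_pos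
  have hw₀p : 0 < w₀ := by positivity
  have hw : Continuous fun s : ℝ ↦ ((w₀ ^ s : ℝ) : ℂ) :=
    Complex.continuous_ofReal.comp (Real.continuous_const_rpow hw₀p.ne')
  set E : ℝ → Cosets N → ℂ := fun s γ ↦
    term N 0 ν τ s γ - ((w₀ ^ s : ℝ) : ℂ) * mainTerm ν τ s (rep γ) with hE
  have hElim : Tendsto (fun s ↦ ∑' γ, E s γ) (𝓝[>] 1) (𝓝 (∑' γ, E 1 γ)) := by
    refine tendsto_tsum_of_dominated_convergence
      (bound := fun γ : Cosets N ↦ C * ‖autj (rep γ) τ‖ ^ (-3 : ℝ))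
      ((summable_norm_autj_rpow N τ (by norm_num)).mul_left C) (fun γ ↦ ?_) ?_
    · have hdet : (rep γ).det ≠ 0 := by rw [det_rep]; norm_num
      have ha : 0 < ‖autj (rep γ) τ‖ := norm_pos_iff.2 (autj_ne_zero hdet τ)
      have hm : Continuous fun s ↦ mainTerm ν τ s (rep γ) := by
        unfold mainTerm
        split_ifs
        · exact continuous_const
        · refine continuous_const.mul (Complex.continuous_ofReal.comp ?_)
          exact (Real.continuous_const_rpow ha.ne').comp (by fun_prop)
      have hc : ContinuousOn (fun s ↦ E s γ) (Set.Icc 1 2) :=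
        (continuousOn_slash_seed 0 ν hν τ 2).sub (hw.mul hm).continuousOn
      exact (hc 1 ⟨le_rfl, by norm_num⟩).mono_left
        (nhdsWithin_le_of_mem (mem_of_superset hsub fun s hs ↦ ⟨hs.1.le, hs.2⟩))
    · filter_upwards [hsub] with s hs γ
      exact hC s ⟨hs.1.le, hs.2⟩ _ (det_rep γ)
  refine ⟨_, Tendsto.congr' ?_ (hElim.add (((hw.tendsto 1).mono_left nhdsWithin_le_nhds).mul hL))⟩
  filter_upwards [hsub] with s hs
  have h1 := summable_term N 0 le_rfl hν τ hs.1
  have h2 : Summable fun γ : Cosets N ↦ ((w₀ ^ s : ℝ) : ℂ) * mainTerm ν τ s (rep γ) :=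
    (Summable.of_norm_bounded (summable_norm_autj_rpow N τ (by linarith [hs.1] : 2 < 2 * s))
      fun γ ↦ norm_mainTerm_le ν τ s _).mul_left _
  rw [← tsum_mul_left, hE, h1.tsum_sub h2, sub_add_cancel, series]

/-- The limit that defines the Maass-Poincaré series exists. -/
lemma tendsto_series (N : ℕ) {k : ℤ} (hk : k ≤ 0) {ν : ℕ} (hν : 0 < ν) (τ : ℍ) :
    Tendsto (series N k ν τ) (𝓝[>] (1 - (k : ℝ) / 2)) (𝓝 (poincare N k ν τ)) := by
  have h : ∃ L, Tendsto (series N k ν τ) (𝓝[>] (1 - (k : ℝ) / 2)) (𝓝 L) := by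
    rcases hk.lt_or_eq with hk | rfl
    · exact ⟨_, tendsto_series_of_neg N k hk hν τ⟩
    · simpa using exists_tendsto_series_zero N hν τ
  exact tendsto_nhds_limUnder h

/-! ### The Hecke correspondence on matrices -/

/-- The matrix `diag(e, 1)`. -/
def dil (e : ℕ) : Matrix (Fin 2) (Fin 2) ℤ := !![(e : ℤ), 0; 0, 1]

lemma det_dil (e : ℕ) : (dil e).det = e := by simp [dil, Matrix.det_fin_two]

/-- The integral matrices of determinant `ν` whose lower left entry is divisible by `N`. -/
def detSet (N ν : ℕ) : Set (Matrix (Fin 2) (Fin 2) ℤ) := {A | A.det = ν ∧ (N : ℤ) ∣ A 1 0}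

/-- Equivalence under left multiplication by the stabilizer of `∞`. -/
def detSetoid (N ν : ℕ) : Setoid (detSet N ν) where
  r A B := ∃ γ ∈ stabInfty,
    (γ : Matrix (Fin 2) (Fin 2) ℤ) * (A : Matrix (Fin 2) (Fin 2) ℤ) = B
  iseqv :=
    { refl := fun A ↦ ⟨1, one_mem _, by simp⟩
      symm := by
        rintro A B ⟨γ, hγ, h⟩
        refine ⟨γ⁻¹, inv_mem hγ, ?_⟩
        rw [← h, ← Matrix.mul_assoc, ← Matrix.SpecialLinearGroup.coe_mul]
        simp
      trans := by
        rintro A B C ⟨γ, hγ, h⟩ ⟨δ, hδ, h'⟩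
        refine ⟨δ * γ, mul_mem hδ hγ, ?_⟩
        rw [Matrix.SpecialLinearGroup.coe_mul, Matrix.mul_assoc, h, h'] }

/-- The quotient of `detSet N ν` by the stabilizer of `∞`. -/
abbrev DetCosets (N ν : ℕ) : Type := Quotient (detSetoid N ν)

lemma mul_apply_fin_two (A B : Matrix (Fin 2) (Fin 2) ℤ) (i j : Fin 2) :
    (A * B) i j = A i 0 * B 0 j + A i 1 * B 1 j := by
  rw [Matrix.mul_apply, Fin.sum_univ_two]

/-- The entries of a product with an element of the stabilizer of `∞`. -/
lemma exists_stabInfty_mul {γ : SL(2, ℤ)} (hγ : γ ∈ stabInfty) (A : Matrix (Fin 2) (Fin 2) ℤ) :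
    ∃ ε t : ℤ, ε * ε = 1 ∧
      ∀ j, ((γ : Matrix (Fin 2) (Fin 2) ℤ) * A) 0 j = ε * A 0 j + t * A 1 j ∧
        ((γ : Matrix (Fin 2) (Fin 2) ℤ) * A) 1 j = ε * A 1 j := by
  obtain ⟨h0, h1, h2⟩ := entries_of_mem_stabInfty hγ
  refine ⟨γ 1 1, γ 0 1, h2, fun j ↦ ⟨?_, ?_⟩⟩
  · rw [mul_apply_fin_two, h1]
  · rw [mul_apply_fin_two, h0]; ring

lemma mem_gamma0_iff_dvd {N : ℕ} {γ : SL(2, ℤ)} :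
    γ ∈ CongruenceSubgroup.Gamma0 N ↔ (N : ℤ) ∣ γ 1 0 := by
  rw [CongruenceSubgroup.Gamma0_mem]
  exact ZMod.intCast_zmod_eq_zero_iff_dvd _ _

lemma stabInfty_le_gamma0 (N : ℕ) : stabInfty ≤ CongruenceSubgroup.Gamma0 N := by
  intro γ hγ
  rw [mem_gamma0_iff_dvd, (entries_of_mem_stabInfty hγ).1]
  exact dvd_zero _

/-- Left multiplication by `Γ₀(M)` preserves `ℳ_m(M)`. -/
lemma gamma0_mul_mem_heckeSet {M m : ℕ} {γ : SL(2, ℤ)} (hγ : γ ∈ CongruenceSubgroup.Gamma0 M)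
    {A : Matrix (Fin 2) (Fin 2) ℤ} (hA : A ∈ heckeSet M m) :
    (γ : Matrix (Fin 2) (Fin 2) ℤ) * A ∈ heckeSet M m := by
  obtain ⟨h1, ⟨u, h2⟩, ⟨x, y, h3⟩⟩ := hA
  obtain ⟨v, hv⟩ := mem_gamma0_iff_dvd.1 hγ
  have hd := γ.det_coe
  rw [Matrix.det_fin_two] at hd
  refine ⟨by rw [Matrix.det_mul, γ.det_coe, one_mul, h1], ?_, ?_⟩
  · rw [mul_apply_fin_two, hv, h2]
    exact ⟨v * A 0 0 + γ 1 1 * u, by ring⟩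
  · rw [mul_apply_fin_two, h2]
    have c1 : IsCoprime (γ 0 0) (M : ℤ) :=
      ⟨γ 1 1, -(γ 0 1 * v), by rw [hv] at hd; linear_combination hd⟩
    have c2 : IsCoprime (γ 0 0 * A 0 0) (M : ℤ) := c1.mul_left ⟨x, y, h3⟩
    have := c2.add_mul_right_left (γ 0 1 * u)
    rwa [show γ 0 0 * A 0 0 + γ 0 1 * (M * u) = γ 0 0 * A 0 0 + γ 0 1 * u * M by ring]

lemma rep_mem {N : ℕ} (γ : Cosets N) : (γ.out : SL(2, ℤ)) ∈ CongruenceSubgroup.Gamma0 N :=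
  γ.out.2

/-- The chosen representative of the class of `γ` differs from `γ` by an element of `Γ_∞`. -/
lemma rep_mk {N : ℕ} {γ : SL(2, ℤ)} (hγ : γ ∈ CongruenceSubgroup.Gamma0 N) :
    ∃ δ ∈ stabInfty, rep (Quotient.mk _ ⟨γ, hγ⟩ : Cosets N) =
      (δ : Matrix (Fin 2) (Fin 2) ℤ) * (γ : Matrix (Fin 2) (Fin 2) ℤ) := by
  set c : Cosets N := Quotient.mk _ ⟨γ, hγ⟩ with hc
  have h : (Quotient.mk _ ⟨γ, hγ⟩ : Cosets N) = Quotient.mk _ c.out := (Quotient.out_eq c).symm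
  rw [coset_mk_eq_iff, ← mul_inv_mem_stabInfty_iff] at h
  refine ⟨_, h, ?_⟩
  rw [← Matrix.SpecialLinearGroup.coe_mul, inv_mul_cancel_right]
  rfl

/-- Classes `(e, β, γ)`, where `e ∣ gcd(N, ν)`, `β ∈ Γ₀(N/e) \ ℳ_{ν/e}(N/e)` and
`γ ∈ Γ_∞ \ Γ₀(N/e)`, grouped by `(e, β)`. -/
abbrev HeckeIndex (N ν : ℕ) : Type :=
  Σ e : {e // e ∈ (Nat.gcd N ν).divisors}, Quotient (heckeSetoid (N / e) (ν / e))

/-- The matrix `γ β diag(e, 1)` attached to the classes of `(e, β, γ)`. -/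
def heckeMat {N ν : ℕ} (x : Σ p : HeckeIndex N ν, Cosets (N / p.1)) :
    Matrix (Fin 2) (Fin 2) ℤ :=
  rep x.2 * (x.1.2.out : Matrix (Fin 2) (Fin 2) ℤ) * dil x.1.1

lemma dvd_of_mem_divisors_gcd {N ν e : ℕ} (he : e ∈ (Nat.gcd N ν).divisors) : e ∣ N ∧ e ∣ ν :=
  Nat.dvd_gcd_iff.1 (Nat.dvd_of_mem_divisors he)

lemma rep_mul_mem {M m : ℕ} (γ : Cosets M) (β : heckeSet M m) :
    rep γ * (β : Matrix (Fin 2) (Fin 2) ℤ) ∈ heckeSet M m :=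
  gamma0_mul_mem_heckeSet (rep_mem γ) β.2

lemma mul_dil_apply (A : Matrix (Fin 2) (Fin 2) ℤ) (e : ℕ) (i : Fin 2) :
    (A * dil e) i 0 = A i 0 * e ∧ (A * dil e) i 1 = A i 1 := by
  constructor <;> rw [mul_apply_fin_two] <;> simp [dil]

lemma heckeMat_mem {N ν : ℕ} (x : Σ p : HeckeIndex N ν, Cosets (N / p.1)) :
    heckeMat x ∈ detSet N ν := by
  obtain ⟨⟨⟨e, he⟩, β⟩, γ⟩ := x
  obtain ⟨hN, hν⟩ := dvd_of_mem_divisors_gcd he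
  obtain ⟨h1, h2, -⟩ := rep_mul_mem γ β.out
  refine ⟨?_, ?_⟩
  · rw [heckeMat, Matrix.det_mul, h1, det_dil]
    exact_mod_cast Nat.div_mul_cancel hν
  · rw [heckeMat, (mul_dil_apply _ _ _).1]
    have : (N : ℤ) = ((N / e : ℕ) : ℤ) * (e : ℤ) := by exact_mod_cast (Nat.div_mul_cancel hN).symm
    rw [this]
    exact mul_dvd_mul h2 dvd_rfl

/-- The class modulo `Γ_∞` of the matrix attached to `(e, β, γ)`. -/
def heckeMap {N ν : ℕ} (x : Σ p : HeckeIndex N ν, Cosets (N / p.1)) : DetCosets N ν :=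
  Quotient.mk _ ⟨heckeMat x, heckeMat_mem x⟩

lemma int_gcd_mul_natCast {a : ℤ} {N e : ℕ} (heN : e ∣ N)
    (h : IsCoprime a ((N / e : ℕ) : ℤ)) : Int.gcd (a * e) N = e := by
  have : (N : ℤ) = ((N / e : ℕ) : ℤ) * (e : ℤ) := by exact_mod_cast (Nat.div_mul_cancel heN).symm
  rw [this, Int.gcd_mul_right, Int.isCoprime_iff_gcd_eq_one.1 h, one_mul, Int.natAbs_natCast]

lemma gcd_of_stabInfty_mul {γ : SL(2, ℤ)} (hγ : γ ∈ stabInfty) {A : Matrix (Fin 2) (Fin 2) ℤ}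
    {N : ℕ} (hA : (N : ℤ) ∣ A 1 0) :
    Int.gcd (((γ : Matrix (Fin 2) (Fin 2) ℤ) * A) 0 0) N = Int.gcd (A 0 0) N := by
  obtain ⟨ε, t, hε, h⟩ := exists_stabInfty_mul hγ A
  obtain ⟨u, hu⟩ := hA
  rw [(h 0).1, hu, show ε * A 0 0 + t * (N * u) = ε * A 0 0 + N * (t * u) by ring,
    Int.gcd_add_mul_left_left]
  rcases Int.isUnit_iff.1 (IsUnit.of_mul_eq_one _ hε) with rfl | rfl <;> simp

lemma mul_right_cancel_of_det_ne_zero {A B C : Matrix (Fin 2) (Fin 2) ℤ} (hC : C.det ≠ 0)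
    (h : A * C = B * C) : A = B := by
  have h1 : C.det • A = C.det • B := by
    have := congrArg (· * C.adjugate) h
    simpa only [Matrix.mul_assoc, Matrix.mul_adjugate, Matrix.mul_smul, Matrix.mul_one] using this
  ext i j
  have := congrFun (congrFun h1 i) j
  simpa [hC] using this

/-- The index `e` is recovered from a matrix `(a b; c d)` in the image as `gcd(a, N)`. -/
lemma heckeMap_injective {N ν : ℕ} (hν : 0 < ν) :
    Function.Injective (heckeMap (N := N) (ν := ν)) := by
  rintro ⟨⟨⟨e, he⟩, β⟩, γ⟩ ⟨⟨⟨e', he'⟩, β'⟩, γ'⟩ h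
  obtain ⟨δ, hδ, h⟩ := Quotient.exact h
  obtain ⟨hN, heν⟩ := dvd_of_mem_divisors_gcd he
  obtain ⟨hN', -⟩ := dvd_of_mem_divisors_gcd he'
  simp only at h
  obtain ⟨-, -, h1⟩ := rep_mul_mem γ β.out
  obtain ⟨-, -, h1'⟩ := rep_mul_mem γ' β'.out
  have hg := gcd_of_stabInfty_mul hδ (heckeMat_mem (N := N) (ν := ν) ⟨⟨⟨e, he⟩, β⟩, γ⟩).2
  rw [h] at hg
  simp only [heckeMat] at hg h
  rw [(mul_dil_apply _ _ _).1, (mul_dil_apply _ _ _).1, int_gcd_mul_natCast hN h1,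
    int_gcd_mul_natCast hN' h1'] at hg
  subst hg
  have he0 : 0 < e' := Nat.pos_of_dvd_of_pos heν hν
  have h2 : (δ : Matrix (Fin 2) (Fin 2) ℤ) * (rep γ * (β.out : Matrix (Fin 2) (Fin 2) ℤ)) =
      rep γ' * (β'.out : Matrix (Fin 2) (Fin 2) ℤ) := by
    refine mul_right_cancel_of_det_ne_zero (C := dil e') ?_ (by rw [Matrix.mul_assoc]; exact h)
    rw [det_dil]; exact_mod_cast he0.ne'
  have h3 : β = β' := by
    rw [← Quotient.out_eq β, ← Quotient.out_eq β']
    refine Quotient.sound ⟨(γ'.out : SL(2, ℤ))⁻¹ * (δ * (γ.out : SL(2, ℤ))),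
      mul_mem (inv_mem (rep_mem γ')) (mul_mem (stabInfty_le_gamma0 _ hδ) (rep_mem γ)), ?_⟩
    rw [Matrix.SpecialLinearGroup.coe_mul, Matrix.SpecialLinearGroup.coe_mul, Matrix.mul_assoc,
      Matrix.mul_assoc]
    change _ * (_ * (rep γ * _)) = _
    rw [h2, rep, ← Matrix.mul_assoc, ← Matrix.SpecialLinearGroup.coe_mul, inv_mul_cancel,
      Matrix.SpecialLinearGroup.coe_one, Matrix.one_mul]
  subst h3
  have h4 : (δ : Matrix (Fin 2) (Fin 2) ℤ) * rep γ = rep γ' := by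
    refine mul_right_cancel_of_det_ne_zero (C := (β.out : Matrix (Fin 2) (Fin 2) ℤ)) ?_
      (by rw [Matrix.mul_assoc]; exact h2)
    rw [β.out.2.1]
    exact_mod_cast (Nat.div_pos (Nat.le_of_dvd hν heν) he0).ne'
  have h5 : γ = γ' := by
    obtain ⟨ε, t, hε, h6⟩ := exists_stabInfty_mul hδ (rep γ)
    rw [coset_eq_iff, ← h4, (h6 0).2, (h6 1).2]
    ring
  rw [h5]

/-- For `(a b; c d)` of determinant `ν` with `N ∣ c`, the number `e = gcd(a, N)` divides both `a`
and `c`, hence `ν`, and splitting off `diag(e, 1)` on the right leaves an element of `ℳ_{ν/e}(N/e)`. -/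
lemma heckeMap_surjective {N ν : ℕ} (hN : 0 < N) (hν : 0 < ν) :
    Function.Surjective (heckeMap (N := N) (ν := ν)) := by
  intro y
  induction y using Quotient.inductionOn with
  | h A =>
  obtain ⟨A, hdet, hdvd⟩ := A
  set e := Int.gcd (A 0 0) N with he
  have he1 : (e : ℤ) ∣ A 0 0 := Int.gcd_dvd_left _ _
  have he2 : (e : ℤ) ∣ (N : ℤ) := Int.gcd_dvd_right _ _
  have he3 : (e : ℤ) ∣ A 1 0 := he2.trans hdvd
  have he4 : (e : ℤ) ∣ (ν : ℤ) := by
    rw [← hdet, Matrix.det_fin_two]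
    exact dvd_sub (he1.mul_right _) (he3.mul_left _)
  have heN : e ∣ N := by exact_mod_cast he2
  have heν : e ∣ ν := by exact_mod_cast he4
  have he0 : 0 < e := Nat.pos_of_dvd_of_pos heν hν
  have he0' : (e : ℤ) ≠ 0 := by exact_mod_cast he0.ne'
  have hmem : e ∈ (Nat.gcd N ν).divisors :=
    Nat.mem_divisors.2 ⟨Nat.dvd_gcd heN heν, (Nat.gcd_pos_of_pos_left _ hN).ne'⟩
  obtain ⟨a, ha⟩ := he1
  obtain ⟨c, hc⟩ := he3
  have hNe : (N : ℤ) = (e : ℤ) * ((N / e : ℕ) : ℤ) := by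
    exact_mod_cast (Nat.mul_div_cancel' heN).symm
  have hB : (!![a, A 0 1; c, A 1 1] : Matrix (Fin 2) (Fin 2) ℤ) ∈ heckeSet (N / e) (ν / e) := by
    refine ⟨?_, ?_, ?_⟩
    · rw [Matrix.det_fin_two_of]
      apply mul_left_cancel₀ he0'
      have : (e : ℤ) * ((ν / e : ℕ) : ℤ) = ν := by exact_mod_cast Nat.mul_div_cancel' heν
      rw [this, ← hdet, Matrix.det_fin_two, ha, hc]
      ring
    · rw [hNe, hc] at hdvd
      exact Int.dvd_of_mul_dvd_mul_left he0' hdvd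
    · change IsCoprime a _
      rw [Int.isCoprime_iff_gcd_eq_one]
      have : e * Int.gcd a ((N / e : ℕ) : ℤ) = e * 1 := by
        conv_rhs => rw [mul_one, he, ha, hNe, Int.gcd_mul_left, Int.natAbs_natCast]
      exact Nat.eq_of_mul_eq_mul_left he0 this
  set β : Quotient (heckeSetoid (N / e) (ν / e)) := Quotient.mk _ ⟨_, hB⟩ with hβ
  obtain ⟨γ, hγ, h1⟩ : ∃ γ ∈ CongruenceSubgroup.Gamma0 (N / e),
      (γ : Matrix (Fin 2) (Fin 2) ℤ) * (β.out : Matrix (Fin 2) (Fin 2) ℤ) =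
        !![a, A 0 1; c, A 1 1] :=
    Quotient.exact (Quotient.out_eq β)
  obtain ⟨δ, hδ, h2⟩ := rep_mk hγ
  refine ⟨⟨⟨⟨e, hmem⟩, β⟩, Quotient.mk _ ⟨γ, hγ⟩⟩, Eq.symm (Quotient.sound ⟨δ, hδ, ?_⟩)⟩
  simp only [heckeMat]
  rw [h2, Matrix.mul_assoc _ _ (Subtype.val _), h1, Matrix.mul_assoc]
  congr 1
  refine (Matrix.eta_fin_two A).trans ?_
  rw [ha, hc, dil, Matrix.mul_fin_two]
  simp [mul_comm]

/-- The Hecke quotient is finite: every class contains an upper triangular matrix with entries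
in `[0, m]`. -/
lemma finite_heckeQuotient {M m : ℕ} (hm : 0 < m) : Finite (Quotient (heckeSetoid M m)) := by
  let mat : Fin (m + 1) × Fin (m + 1) × Fin (m + 1) → Matrix (Fin 2) (Fin 2) ℤ := fun x ↦
    !![((x.1 : ℕ) : ℤ), ((x.2.1 : ℕ) : ℤ); 0, ((x.2.2 : ℕ) : ℤ)]
  refine Finite.of_surjective
    (fun x : {x // mat x ∈ heckeSet M m} ↦ (Quotient.mk (heckeSetoid M m) ⟨mat x, x.2⟩)) ?_
  intro y
  induction y using Quotient.inductionOn with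
  | h A =>
  obtain ⟨A, hA⟩ := A
  obtain ⟨hdet, hdvd, hco⟩ := id hA
  rw [Matrix.det_fin_two] at hdet
  have hne : A 0 0 ≠ 0 ∨ A 1 0 ≠ 0 := by
    by_contra! h
    rw [h.1, h.2] at hdet
    simp at hdet
    omega
  have hg : 0 < Int.gcd (A 0 0) (A 1 0) := by
    rcases hne with h | h
    · exact Int.gcd_pos_of_ne_zero_left _ h
    · exact Int.gcd_pos_of_ne_zero_right _ h
  obtain ⟨a, c, hac, ha, hc⟩ := Int.exists_gcd_one hg
  set h : ℤ := (Int.gcd (A 0 0) (A 1 0) : ℤ) with hh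
  have hh0 : 0 < h := by rw [hh]; exact_mod_cast hg
  obtain ⟨p, q, hpq⟩ := Int.isCoprime_iff_gcd_eq_one.2 hac
  have hMc : (M : ℤ) ∣ c := by
    have h1 : IsCoprime (M : ℤ) h := by
      rw [ha] at hco
      exact hco.of_mul_left_right.symm
    exact h1.dvd_of_dvd_mul_right (by rwa [← hc])
  set f : ℤ := a * A 1 1 - c * A 0 1 with hf
  have hhf : h * f = m := by rw [hf, ← hdet, ha, hc]; ring
  have hm' : (0 : ℤ) < m := by exact_mod_cast hm
  have hf0 : 0 < f := pos_of_mul_pos_right (by rw [hhf]; exact hm') hh0.le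
  set t : ℤ := p * A 0 1 + q * A 1 1 with ht
  set b : ℤ := t % f with hb
  have hb0 : 0 ≤ b := Int.emod_nonneg _ hf0.ne'
  have hbf : b < f := Int.emod_lt_of_pos _ hf0
  have hbt : b = t - f * (t / f) := by rw [hb]; have := Int.mul_ediv_add_emod t f; linarith
  have hhm : h ≤ m := by nlinarith
  have hfm : f ≤ m := by nlinarith
  let γ : SL(2, ℤ) := ⟨!![p + (t / f) * c, q - (t / f) * a; -c, a], by
    rw [Matrix.det_fin_two_of]; linear_combination hpq⟩
  have hγ : γ ∈ CongruenceSubgroup.Gamma0 M :=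
    mem_gamma0_iff_dvd.2 ((dvd_neg).2 hMc)
  let x : Fin (m + 1) × Fin (m + 1) × Fin (m + 1) :=
    (⟨h.toNat, by omega⟩, ⟨b.toNat, by omega⟩, ⟨f.toNat, by omega⟩)
  have hx : (γ : Matrix (Fin 2) (Fin 2) ℤ) * A = mat x := by
    have e1 : ((h.toNat : ℕ) : ℤ) = h := Int.toNat_of_nonneg hh0.le
    have e2 : ((b.toNat : ℕ) : ℤ) = b := Int.toNat_of_nonneg hb0
    have e3 : ((f.toNat : ℕ) : ℤ) = f := Int.toNat_of_nonneg hf0.le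
    have g1 : γ 0 0 = p + (t / f) * c := rfl
    have g2 : γ 0 1 = q - (t / f) * a := rfl
    have g3 : γ 1 0 = -c := rfl
    have g4 : γ 1 1 = a := rfl
    ext i j
    rw [mul_apply_fin_two]
    fin_cases i <;> fin_cases j <;> simp only [Fin.zero_eta, Fin.mk_one, g1, g2, g3, g4, mat, x,
      Matrix.of_apply, Matrix.cons_val_zero, Matrix.cons_val_one, e1, e2, e3,
      Matrix.cons_val', Matrix.cons_val_fin_one]
    · rw [ha, hc]; linear_combination h * hpq
    · rw [hbt, ht]
      linear_combination (t / f) * hf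
    · rw [ha, hc]; ring
    · rw [hf]; ring
  have hxm : mat x ∈ heckeSet M m := by
    rw [← hx]; exact gamma0_mul_mem_heckeSet hγ hA
  exact ⟨⟨x, hxm⟩, Eq.symm (Quotient.sound ⟨γ, hγ, hx⟩)⟩

/-! ### The Hecke relation -/

lemma opB_eq (e : ℕ) (f : ℍ → ℂ) (τ : ℍ) : opB e f τ = f (mob (dil e) τ) := by
  simp [opB, mob, autj, dil]

lemma coe_mob_dil {e : ℕ} (he : 0 < e) (τ : ℍ) : (mob (dil e) τ : ℂ) = e * τ := by
  rw [coe_mob (by rw [det_dil]; exact_mod_cast he)]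
  simp [autj, dil]

lemma seed_mob_dil (k : ℤ) {ν : ℕ} (hν : 0 < ν) (s : ℝ) (z : ℍ) :
    seed k 1 s (mob (dil ν) z) = seed k ν s z := by
  have h := coe_mob_dil hν z
  have him : (mob (dil ν) z).im = ν * z.im := by
    have := congrArg Complex.im h; simpa using this
  have hre : (mob (dil ν) z).re = ν * z.re := by
    have := congrArg Complex.re h; simpa using this
  simp only [seed, him, hre]
  rw [show 4 * Real.pi * ((1 : ℕ) : ℝ) * (ν * z.im) = 4 * Real.pi * ν * z.im by push_cast; ring]
  congr 2
  push_cast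
  ring

lemma slash_dil (k : ℤ) (e : ℕ) (f : ℍ → ℂ) (τ : ℍ) :
    slash k (dil e) f τ = (((e : ℝ) ^ ((k : ℝ) / 2) : ℝ) : ℂ) * f (mob (dil e) τ) := by
  rw [slash_eq, det_dil]
  have : autj (dil e) τ = 1 := by simp [autj, dil]
  rw [this, one_zpow, mul_one, Int.cast_natCast]

/-- The summand `(φ_{1,s}|_k A)(τ)` as a function of the class of `A` modulo `Γ_∞`. -/
def detTerm {N ν : ℕ} (hν : 0 < ν) {k : ℤ} (hk : Even k) (s : ℝ) (τ : ℍ) : DetCosets N ν → ℂ :=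
  Quotient.lift (fun A ↦ slash k (A : Matrix (Fin 2) (Fin 2) ℤ) (seed k 1 s) τ) (by
    rintro A B ⟨γ, hγ, h⟩
    rw [← h, slash_stabInfty_mul_seed hk 1 s hγ (by rw [A.2.1]; exact_mod_cast hν)])

/-- The greatest common divisor of the bottom row. -/
def bottomGcd {N ν : ℕ} : DetCosets N ν → ℕ :=
  Quotient.lift (fun A ↦ Int.gcd ((A : Matrix (Fin 2) (Fin 2) ℤ) 1 0)
    ((A : Matrix (Fin 2) (Fin 2) ℤ) 1 1)) (by
    rintro A B ⟨γ, hγ, h⟩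
    obtain ⟨ε, t, hε, h1⟩ := exists_stabInfty_mul hγ (A : Matrix (Fin 2) (Fin 2) ℤ)
    rw [← h, (h1 0).2, (h1 1).2]
    rcases Int.isUnit_iff.1 (IsUnit.of_mul_eq_one _ hε) with rfl | rfl <;> simp)

/-- Left multiplication by the translation `(1 u/g; 0 1)`, where `g` is the greatest common divisor
of the bottom row. -/
def shiftMat (u : ℤ) (A : Matrix (Fin 2) (Fin 2) ℤ) : Matrix (Fin 2) (Fin 2) ℤ :=
  !![A 0 0 + u * (A 1 0 / (Int.gcd (A 1 0) (A 1 1) : ℤ)),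
    A 0 1 + u * (A 1 1 / (Int.gcd (A 1 0) (A 1 1) : ℤ)); A 1 0, A 1 1]

lemma gcd_bottom_pos {A : Matrix (Fin 2) (Fin 2) ℤ} (hA : A.det ≠ 0) :
    0 < Int.gcd (A 1 0) (A 1 1) := by
  rcases bottom_ne_zero hA with h | h
  · exact Int.gcd_pos_of_ne_zero_left _ h
  · exact Int.gcd_pos_of_ne_zero_right _ h

lemma shiftMat_mem {N ν : ℕ} (hν : 0 < ν) (u : ℤ) {A : Matrix (Fin 2) (Fin 2) ℤ}
    (hA : A ∈ detSet N ν) : shiftMat u A ∈ detSet N ν := by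
  obtain ⟨h1, h2⟩ := hA
  refine ⟨?_, h2⟩
  have hg := gcd_bottom_pos (A := A) (by rw [h1]; exact_mod_cast hν.ne')
  have hg0 : (Int.gcd (A 1 0) (A 1 1) : ℤ) ≠ 0 := by exact_mod_cast hg.ne'
  obtain ⟨c, hc⟩ : (Int.gcd (A 1 0) (A 1 1) : ℤ) ∣ A 1 0 := Int.gcd_dvd_left _ _
  obtain ⟨d, hd⟩ : (Int.gcd (A 1 0) (A 1 1) : ℤ) ∣ A 1 1 := Int.gcd_dvd_right _ _
  rw [← h1, shiftMat, Matrix.det_fin_two_of, Matrix.det_fin_two]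
  have e1 : A 1 0 / (Int.gcd (A 1 0) (A 1 1) : ℤ) = c := Int.ediv_eq_of_eq_mul_right hg0 hc
  have e2 : A 1 1 / (Int.gcd (A 1 0) (A 1 1) : ℤ) = d := Int.ediv_eq_of_eq_mul_right hg0 hd
  rw [e1, e2]
  linear_combination u * c * hd - u * d * hc

lemma shiftMat_shiftMat_neg (u : ℤ) (A : Matrix (Fin 2) (Fin 2) ℤ) :
    shiftMat (-u) (shiftMat u A) = A := by
  refine Eq.trans ?_ (Matrix.eta_fin_two A).symm
  simp [shiftMat]

lemma shiftMat_stabInfty_mul (u : ℤ) {γ : SL(2, ℤ)} (hγ : γ ∈ stabInfty)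
    (A : Matrix (Fin 2) (Fin 2) ℤ) :
    (γ : Matrix (Fin 2) (Fin 2) ℤ) * shiftMat u A =
      shiftMat u ((γ : Matrix (Fin 2) (Fin 2) ℤ) * A) := by
  obtain ⟨h0, h1, h2⟩ := entries_of_mem_stabInfty hγ
  have e : ∀ B : Matrix (Fin 2) (Fin 2) ℤ, (γ : Matrix (Fin 2) (Fin 2) ℤ) * B =
      !![γ 1 1 * B 0 0 + γ 0 1 * B 1 0, γ 1 1 * B 0 1 + γ 0 1 * B 1 1;
        γ 1 1 * B 1 0, γ 1 1 * B 1 1] := fun B ↦ by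
    refine (Matrix.eta_fin_two _).trans ?_
    simp only [mul_apply_fin_two, h0, h1, zero_mul, zero_add]
  rw [e, e]
  rcases Int.isUnit_iff.1 (IsUnit.of_mul_eq_one _ h2) with h | h
  · simp only [shiftMat, h]
    simp
    constructor <;> ring
  · simp only [shiftMat, h]
    simp
    rw [Int.neg_ediv_of_dvd (Int.gcd_dvd_left _ _), Int.neg_ediv_of_dvd (Int.gcd_dvd_right _ _)]
    constructor <;> ring

/-- The shift `shiftMat u` on classes modulo `Γ_∞`. -/
def shift {N ν : ℕ} (hν : 0 < ν) (u : ℤ) : DetCosets N ν → DetCosets N ν :=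
  Quotient.map (fun A ↦ ⟨shiftMat u A, shiftMat_mem hν u A.2⟩) (by
    rintro A B ⟨γ, hγ, h⟩
    refine ⟨γ, hγ, ?_⟩
    simp only
    rw [shiftMat_stabInfty_mul u hγ, h])

/-- The shift `shiftMat 1` as a permutation of the classes modulo `Γ_∞`. -/
def shiftEquiv {N ν : ℕ} (hν : 0 < ν) : DetCosets N ν ≃ DetCosets N ν where
  toFun := shift hν 1
  invFun := shift hν (-1)
  left_inv y := by
    induction y using Quotient.inductionOn with
    | h A =>
    refine congrArg (Quotient.mk _) (Subtype.ext ?_)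
    exact shiftMat_shiftMat_neg 1 _
  right_inv y := by
    induction y using Quotient.inductionOn with
    | h A =>
    refine congrArg (Quotient.mk _) (Subtype.ext ?_)
    simpa using shiftMat_shiftMat_neg (-1) (A : Matrix (Fin 2) (Fin 2) ℤ)

lemma bottomGcd_shiftEquiv {N ν : ℕ} (hν : 0 < ν) (y : DetCosets N ν) :
    bottomGcd (shiftEquiv hν y) = bottomGcd y := by
  induction y using Quotient.inductionOn with
  | h A => rfl

lemma seed_translate (k : ℤ) (s : ℝ) (x : ℝ) {z z' : ℍ} (h : (z' : ℂ) = z + x) :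
    seed k 1 s z' = Complex.exp (-2 * Real.pi * Complex.I * x) * seed k 1 s z := by
  have him : z'.im = z.im := by
    have := congrArg Complex.im h; simpa using this
  have hre : z'.re = z.re + x := by
    have := congrArg Complex.re h; simpa using this
  simp only [seed, him, hre]
  rw [mul_left_comm, ← Complex.exp_add]
  congr 2
  push_cast
  ring

/-- The shift translates `Aτ` by `1/g`, where `g` is the greatest common divisor of the bottom
row. -/
lemma detTerm_shiftEquiv {N ν : ℕ} (hν : 0 < ν) {k : ℤ} (hk : Even k) (s : ℝ) (τ : ℍ)
    (y : DetCosets N ν) : detTerm hν hk s τ (shiftEquiv hν y) =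
      Complex.exp (-2 * Real.pi * Complex.I * ((bottomGcd y : ℝ)⁻¹ : ℝ)) *
        detTerm hν hk s τ y := by
  induction y using Quotient.inductionOn with
  | h A =>
  obtain ⟨A, hA⟩ := A
  have hdet : 0 < A.det := by rw [hA.1]; exact_mod_cast hν
  have hA' := shiftMat_mem hν 1 hA
  have hdet' : 0 < (shiftMat 1 A).det := by rw [hA'.1]; exact_mod_cast hν
  change slash k (shiftMat 1 A) (seed k 1 s) τ =
    Complex.exp (-2 * Real.pi * Complex.I * ((Int.gcd (A 1 0) (A 1 1) : ℝ)⁻¹ : ℝ)) *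
      slash k A (seed k 1 s) τ
  have hj : autj (shiftMat 1 A) τ = autj A τ := rfl
  have hj0 := autj_ne_zero hdet.ne' τ
  rw [slash_eq, slash_eq, hj, hA.1, hA'.1,
    seed_translate k s (Int.gcd (A 1 0) (A 1 1) : ℝ)⁻¹ (z := mob A τ) (z' := mob (shiftMat 1 A) τ)]
  · ring
  · have hg := gcd_bottom_pos hdet.ne'
    have hg0 : (Int.gcd (A 1 0) (A 1 1) : ℤ) ≠ 0 := by exact_mod_cast hg.ne'
    have hgC : ((Int.gcd (A 1 0) (A 1 1) : ℕ) : ℂ) ≠ 0 := by exact_mod_cast hg.ne'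
    obtain ⟨c, hc⟩ : (Int.gcd (A 1 0) (A 1 1) : ℤ) ∣ A 1 0 := Int.gcd_dvd_left _ _
    obtain ⟨d, hd⟩ : (Int.gcd (A 1 0) (A 1 1) : ℤ) ∣ A 1 1 := Int.gcd_dvd_right _ _
    have e1 : shiftMat 1 A 0 0 = A 0 0 + c := by
      change A 0 0 + 1 * (A 1 0 / (Int.gcd (A 1 0) (A 1 1) : ℤ)) = _
      rw [one_mul, Int.ediv_eq_of_eq_mul_right hg0 hc]
    have e2 : shiftMat 1 A 0 1 = A 0 1 + d := by
      change A 0 1 + 1 * (A 1 1 / (Int.gcd (A 1 0) (A 1 1) : ℤ)) = _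
      rw [one_mul, Int.ediv_eq_of_eq_mul_right hg0 hd]
    have hc' : (A 1 0 : ℂ) = (Int.gcd (A 1 0) (A 1 1) : ℕ) * c := by exact_mod_cast hc
    have hd' : (A 1 1 : ℂ) = (Int.gcd (A 1 0) (A 1 1) : ℕ) * d := by exact_mod_cast hd
    have hj' : autj A τ = (Int.gcd (A 1 0) (A 1 1) : ℕ) * (c * τ + d) := by
      have : autj A τ = (A 1 0 : ℂ) * τ + (A 1 1 : ℂ) := rfl
      rw [this]
      linear_combination (τ : ℂ) * hc' + hd'
    rw [coe_mob hdet', coe_mob hdet, hj, e1, e2, div_add' _ _ _ hj0]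
    congr 1
    push_cast
    rw [hj', ← mul_assoc, inv_mul_cancel₀ hgC]
    ring

lemma bottomGcd_dvd {N ν : ℕ} (y : DetCosets N ν) : bottomGcd y ∣ ν := by
  induction y using Quotient.inductionOn with
  | h A =>
  obtain ⟨A, hA⟩ := A
  change Int.gcd (A 1 0) (A 1 1) ∣ ν
  have : (Int.gcd (A 1 0) (A 1 1) : ℤ) ∣ ν := by
    rw [← hA.1, Matrix.det_fin_two]
    exact dvd_sub ((Int.gcd_dvd_right _ _).mul_left _) ((Int.gcd_dvd_left _ _).mul_left _)
  exact_mod_cast this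

lemma exp_inv_ne_one {g : ℕ} (hg : 1 < g) :
    Complex.exp (-2 * Real.pi * Complex.I * ((g : ℝ)⁻¹ : ℝ)) ≠ 1 := by
  intro h
  obtain ⟨n, hn⟩ := Complex.exp_eq_one_iff.1 h
  have hg0 : (g : ℂ) ≠ 0 := by exact_mod_cast (by omega : g ≠ 0)
  have h1 : (2 * Real.pi * Complex.I) * (-1) = (2 * Real.pi * Complex.I) * (n * g) := by
    push_cast at hn
    field_simp at hn
    linear_combination (2 * Real.pi * Complex.I) * hn
  have h2 := mul_left_cancel₀ Complex.two_pi_I_ne_zero h1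
  have h3 : (-1 : ℤ) = n * g := by exact_mod_cast h2
  have h4 : (g : ℤ) ∣ 1 := ⟨-n, by linarith⟩
  have := Int.le_of_dvd one_pos h4
  omega

/-- Only the classes with coprime bottom row contribute: on the others, the shift multiplies the
summand by a nontrivial root of unity. -/
lemma tsum_detTerm_eq {N ν : ℕ} (hν : 0 < ν) {k : ℤ} (hk : Even k) (s : ℝ) (τ : ℍ)
    (hs : Summable (detTerm (N := N) hν hk s τ)) :
    ∑' y : DetCosets N ν, detTerm hν hk s τ y =
      ∑' y : DetCosets N ν, if bottomGcd y = 1 then detTerm hν hk s τ y else 0 := by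
  set f : ℕ → DetCosets N ν → ℂ := fun g y ↦
    if bottomGcd y = g then detTerm hν hk s τ y else 0 with hf
  have hsum : ∀ g, Summable (f g) := fun g ↦ by
    refine Summable.of_norm_bounded hs.norm fun y ↦ ?_
    simp only [hf]
    split_ifs <;> simp
  have h1 : ∀ y, detTerm hν hk s τ y = ∑ g ∈ ν.divisors, f g y := fun y ↦ by
    simp only [hf]
    rw [Finset.sum_ite_eq, if_pos (Nat.mem_divisors.2 ⟨bottomGcd_dvd y, hν.ne'⟩)]
  calc ∑' y : DetCosets N ν, detTerm hν hk s τ y = ∑ g ∈ ν.divisors, ∑' y, f g y := by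
        rw [← Summable.tsum_finsetSum fun g _ ↦ hsum g]
        exact tsum_congr h1
    _ = ∑' y, f 1 y := by
        refine Finset.sum_eq_single_of_mem 1 (Nat.one_mem_divisors.2 hν.ne') fun g hg hg1 ↦ ?_
        have hg' : 1 < g := by
          have := Nat.pos_of_mem_divisors hg
          omega
        have e1 := (shiftEquiv (N := N) hν).tsum_eq (f g)
        have e2 : ∀ y, f g (shiftEquiv hν y) =
            Complex.exp (-2 * Real.pi * Complex.I * ((g : ℝ)⁻¹ : ℝ)) * f g y := fun y ↦ by
          simp only [hf, bottomGcd_shiftEquiv]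
          split_ifs with h
          · rw [detTerm_shiftEquiv, h]
          · simp
        simp only [e2] at e1
        rw [tsum_mul_left] at e1
        by_contra h0
        exact exp_inv_ne_one hg' (mul_right_cancel₀ h0 (by rw [e1, one_mul]))

/-- Matrices of equal determinant whose bottom rows are coprime and agree up to sign are
equivalent modulo `Γ_∞`. -/
lemma exists_stabInfty_of_bottom {A B : Matrix (Fin 2) (Fin 2) ℤ} (hdet : A.det = B.det)
    {ε : ℤ} (hε : ε * ε = 1) (h0 : B 1 0 = ε * A 1 0) (h1 : B 1 1 = ε * A 1 1)
    (hco : IsCoprime (A 1 0) (A 1 1)) :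
    ∃ γ ∈ stabInfty, (γ : Matrix (Fin 2) (Fin 2) ℤ) * A = B := by
  obtain ⟨u, v, huv⟩ := hco
  rw [Matrix.det_fin_two, Matrix.det_fin_two, h0, h1] at hdet
  set t : ℤ := (B 0 0 - ε * A 0 0) * u + (B 0 1 - ε * A 0 1) * v with ht
  have key : (B 0 0 - ε * A 0 0) * A 1 1 = (B 0 1 - ε * A 0 1) * A 1 0 := by
    linear_combination (-ε) * hdet + (-(B 0 0 * A 1 1) + B 0 1 * A 1 0) * hε
  refine ⟨⟨!![ε, t; 0, ε], by rw [Matrix.det_fin_two_of]; linarith⟩, rfl, ?_⟩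
  refine Eq.trans ?_ (Matrix.eta_fin_two B).symm
  refine (Matrix.eta_fin_two _).trans ?_
  simp only [mul_apply_fin_two, Matrix.of_apply, Matrix.cons_val', Matrix.cons_val_zero,
    Matrix.cons_val_one, Matrix.cons_val_fin_one, zero_mul, zero_add]
  congr! 3
  · rw [ht]; linear_combination (B 0 0 - ε * A 0 0) * huv - v * key
  · congr! 1
    rw [ht]; linear_combination (B 0 1 - ε * A 0 1) * huv + u * key
  · congr! 1
    exacts [h0.symm, by congr! 1; exact h1.symm]

lemma dil_mul_apply (ν : ℕ) (A : Matrix (Fin 2) (Fin 2) ℤ) (j : Fin 2) :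
    (dil ν * A) 1 j = A 1 j := by
  rw [mul_apply_fin_two]; simp [dil]

lemma dil_mul_rep_mem {N ν : ℕ} (γ : Cosets N) : dil ν * rep γ ∈ detSet N ν := by
  refine ⟨by rw [Matrix.det_mul, det_dil, det_rep, mul_one], ?_⟩
  rw [dil_mul_apply]
  exact dvd_rep γ

/-- The classes with coprime bottom row are those of `diag(ν, 1) γ` for `γ ∈ Γ_∞ \ Γ₀(N)`. -/
lemma tsum_coprime_eq {N ν : ℕ} (hν : 0 < ν) {k : ℤ} (hk : Even k) (s : ℝ) (τ : ℍ) :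
    (∑' y : DetCosets N ν, if bottomGcd y = 1 then detTerm hν hk s τ y else 0) =
      ∑' γ : Cosets N, slash k (dil ν * rep γ) (seed k 1 s) τ := by
  let ι : Cosets N → DetCosets N ν := fun γ ↦ Quotient.mk _ ⟨dil ν * rep γ, dil_mul_rep_mem γ⟩
  have hι : ∀ γ, bottomGcd (ι γ) = 1 := fun γ ↦ by
    change Int.gcd ((dil ν * rep γ) 1 0) ((dil ν * rep γ) 1 1) = 1
    rw [dil_mul_apply, dil_mul_apply, ← Int.isCoprime_iff_gcd_eq_one]
    have := det_rep γ
    rw [Matrix.det_fin_two] at this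
    exact ⟨-rep γ 0 1, rep γ 0 0, by linarith⟩
  have hinj : Function.Injective ι := by
    intro γ γ' h
    obtain ⟨δ, hδ, h⟩ := Quotient.exact h
    obtain ⟨ε, t, hε, h1⟩ := exists_stabInfty_mul hδ (dil ν * rep γ)
    simp only at h
    rw [h] at h1
    have e0 := (h1 0).2
    have e1 := (h1 1).2
    rw [dil_mul_apply, dil_mul_apply] at e0 e1
    rw [coset_eq_iff, e0, e1]
    ring
  rw [← hinj.tsum_eq (f := fun y ↦ if bottomGcd y = 1 then detTerm hν hk s τ y else 0)]
  · refine tsum_congr fun γ ↦ ?_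
    rw [if_pos (hι γ)]
    rfl
  · intro y hy
    have hy1 : bottomGcd y = 1 := by
      by_contra h
      exact hy (if_neg h)
    clear hy
    induction y using Quotient.inductionOn with
    | h A =>
    obtain ⟨A, hA⟩ := A
    have hco : IsCoprime (A 1 0) (A 1 1) := Int.isCoprime_iff_gcd_eq_one.2 hy1
    obtain ⟨u, v, huv⟩ := id hco
    let γ : SL(2, ℤ) := ⟨!![v, -u; A 1 0, A 1 1], by rw [Matrix.det_fin_two_of]; linarith⟩
    have hγ : γ ∈ CongruenceSubgroup.Gamma0 N := mem_gamma0_iff_dvd.2 hA.2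
    obtain ⟨δ, hδ, h2⟩ := rep_mk hγ
    obtain ⟨ε, t, hε, h3⟩ := exists_stabInfty_mul hδ (γ : Matrix (Fin 2) (Fin 2) ℤ)
    rw [← h2] at h3
    refine ⟨Quotient.mk _ ⟨γ, hγ⟩, Eq.symm (Quotient.sound ?_)⟩
    refine exists_stabInfty_of_bottom (ε := ε) ?_ hε ?_ ?_ hco
    · rw [hA.1, (dil_mul_rep_mem (ν := ν) _).1]
    · exact (dil_mul_apply ν _ 0).trans (h3 0).2
    · exact (dil_mul_apply ν _ 1).trans (h3 1).2

lemma slash_rep_mul {M : ℕ} (k : ℤ) {B : Matrix (Fin 2) (Fin 2) ℤ} (hB : 0 < B.det) (s : ℝ)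
    (τ : ℍ) (γ : Cosets M) : slash k (rep γ * B) (seed k 1 s) τ =
      (((B.det : ℝ) ^ ((k : ℝ) / 2) : ℝ) : ℂ) * autj B τ ^ (-k) * term M k 1 (mob B τ) s γ := by
  rw [slash_mul k (by rw [det_rep]; norm_num) hB, slash_eq k B]
  rfl

lemma summable_slash_rep_mul (M : ℕ) {k : ℤ} (hk : k ≤ 0) {B : Matrix (Fin 2) (Fin 2) ℤ}
    (hB : 0 < B.det) {s : ℝ} (hs : 1 < s) (τ : ℍ) :
    Summable fun γ : Cosets M ↦ slash k (rep γ * B) (seed k 1 s) τ := by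
  simp only [slash_rep_mul k hB]
  exact (summable_term M k hk one_pos _ hs).mul_left _

lemma tsum_slash_rep_mul (M : ℕ) (k : ℤ) {B : Matrix (Fin 2) (Fin 2) ℤ}
    (hB : 0 < B.det) (s : ℝ) (τ : ℍ) :
    ∑' γ : Cosets M, slash k (rep γ * B) (seed k 1 s) τ =
      slash k B (fun z ↦ series M k 1 z s) τ := by
  simp only [slash_rep_mul k hB]
  rw [tsum_mul_left, slash_eq]
  rfl

lemma series_eq_tsum_dil (N : ℕ) {k : ℤ} {ν : ℕ} (hν : 0 < ν) (s : ℝ) (τ : ℍ) :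
    ∑' γ : Cosets N, slash k (dil ν * rep γ) (seed k 1 s) τ =
      (((ν : ℝ) ^ ((k : ℝ) / 2) : ℝ) : ℂ) * series N k ν τ s := by
  rw [series, ← tsum_mul_left]
  refine tsum_congr fun γ ↦ ?_
  rw [slash_mul k (by rw [det_dil]; exact_mod_cast hν) (by rw [det_rep]; norm_num), term_eq,
    slash_eq k (rep γ), slash_eq k (rep γ), slash_dil, seed_mob_dil k hν]
  ring

/-- The level-lowering Hecke relation for the series in the region of absolute convergence. -/
lemma series_eq_sum_heckeT {N ν : ℕ} (hN : 0 < N) (hν : 0 < ν) {k : ℤ} (hk : k ≤ 0) (hk2 : Even k)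
    {s : ℝ} (hs : 1 < s) (τ : ℍ) : series N k ν τ s =
      ∑ d ∈ (Nat.gcd N ν).divisors, ((ν / d : ℕ) : ℂ) ^ (1 - k) *
        opB d (heckeT (N / d) k (ν / d) (fun z ↦ series (N / d) k 1 z s)) τ := by
  have hνd : ∀ e ∈ (Nat.gcd N ν).divisors, 0 < e ∧ 0 < ν / e ∧ ν / e * e = ν := fun e he ↦ by
    have h1 := (dvd_of_mem_divisors_gcd he).2
    have h2 := Nat.pos_of_dvd_of_pos h1 hν
    exact ⟨h2, Nat.div_pos (Nat.le_of_dvd hν h1) h2, Nat.div_mul_cancel h1⟩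
  have hfin : ∀ e : {e // e ∈ (Nat.gcd N ν).divisors},
      Fintype (Quotient (heckeSetoid (N / e) (ν / e))) := fun e ↦
    have := finite_heckeQuotient (M := N / e) (hνd e e.2).2.1
    Fintype.ofFinite _
  let e : (Σ p : HeckeIndex N ν, Cosets (N / p.1)) ≃ DetCosets N ν :=
    Equiv.ofBijective heckeMap ⟨heckeMap_injective hν, heckeMap_surjective hN hν⟩
  -- the right factor `β diag(e, 1)` of the matrices in the fibre over `(e, β)`
  obtain ⟨B, hBe⟩ : ∃ B : HeckeIndex N ν → Matrix (Fin 2) (Fin 2) ℤ,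
      ∀ p, B p = (p.2.out : Matrix (Fin 2) (Fin 2) ℤ) * dil p.1 := ⟨_, fun _ ↦ rfl⟩
  have hB : ∀ p, 0 < (B p).det := fun p ↦ by
    rw [hBe, Matrix.det_mul, p.2.out.2.1, det_dil]
    obtain ⟨h1, h2, -⟩ := hνd p.1 p.1.2
    exact_mod_cast Nat.mul_pos h2 h1
  have hterm : ∀ x : Σ p : HeckeIndex N ν, Cosets (N / p.1),
      detTerm hν hk2 s τ (e x) = slash k (rep x.2 * B x.1) (seed k 1 s) τ := fun x ↦ by
    rw [hBe, ← Matrix.mul_assoc]; rfl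
  have hrow : ∀ p : HeckeIndex N ν, Summable fun γ : Cosets (N / p.1) ↦
      slash k (rep γ * B p) (seed k 1 s) τ := fun p ↦
    summable_slash_rep_mul (N / p.1) hk (hB p) hs τ
  have hsumI : Summable fun x : Σ p : HeckeIndex N ν, Cosets (N / p.1) ↦
      slash k (rep x.2 * B x.1) (seed k 1 s) τ := by
    refine Summable.of_norm ((summable_sigma_of_nonneg fun _ ↦ norm_nonneg _).2 ⟨fun p ↦ ?_, ?_⟩)
    · exact (hrow p).norm
    · exact Summable.of_finite
  have hsumY : Summable (detTerm (N := N) hν hk2 s τ) := by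
    rw [← e.summable_iff]
    exact hsumI.congr fun x ↦ (hterm x).symm
  have hmain : (((ν : ℝ) ^ ((k : ℝ) / 2) : ℝ) : ℂ) * series N k ν τ s =
      ∑ p : HeckeIndex N ν, slash k (B p) (fun z ↦ series (N / p.1) k 1 z s) τ := by
    rw [← series_eq_tsum_dil N hν, ← tsum_coprime_eq hν hk2, ← tsum_detTerm_eq hν hk2 s τ hsumY,
      ← e.tsum_eq]
    simp only [hterm]
    rw [hsumI.tsum_sigma' hrow, tsum_fintype]
    exact Finset.sum_congr rfl fun p _ ↦ tsum_slash_rep_mul (N / p.1) k (hB p) s τ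
  have hν0 : (0 : ℝ) < ν := by exact_mod_cast hν
  have hνk : (((ν : ℝ) ^ ((k : ℝ) / 2) : ℝ) : ℂ) ≠ 0 := by
    exact_mod_cast (Real.rpow_pos_of_pos hν0 _).ne'
  apply mul_left_cancel₀ hνk
  rw [hmain, Fintype.sum_sigma, Finset.mul_sum]
  refine Eq.trans (Fintype.sum_congr _ _ fun d ↦ ?_) (Finset.sum_coe_sort (Nat.gcd N ν).divisors _)
  obtain ⟨hd, hm, hmd⟩ := hνd d d.2
  have hd0 : (0 : ℝ) < (d : ℕ) := by exact_mod_cast hd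
  have hm0 : (0 : ℝ) < (ν / d : ℕ) := by exact_mod_cast hm
  have hpow : (((ν : ℝ) ^ ((k : ℝ) / 2) : ℝ) : ℂ) * ((ν / d : ℕ) : ℂ) ^ (1 - k) *
      ((((ν / d : ℕ) : ℝ) ^ ((k : ℝ) / 2 - 1) : ℝ) : ℂ) =
        ((((d : ℕ) : ℝ) ^ ((k : ℝ) / 2) : ℝ) : ℂ) := by
    have h1 : (ν : ℝ) ^ ((k : ℝ) / 2) =
        ((ν / d : ℕ) : ℝ) ^ ((k : ℝ) / 2) * ((d : ℕ) : ℝ) ^ ((k : ℝ) / 2) := by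
      rw [← Real.mul_rpow hm0.le hd0.le, ← Nat.cast_mul, hmd]
    have h2 : ((ν / d : ℕ) : ℝ) ^ ((k : ℝ) / 2) * (((ν / d : ℕ) : ℝ) ^ (1 - k) *
        ((ν / d : ℕ) : ℝ) ^ ((k : ℝ) / 2 - 1)) = 1 := by
      rw [← Real.rpow_intCast, ← Real.rpow_add hm0, ← Real.rpow_add hm0]
      push_cast
      rw [show (k : ℝ) / 2 + (1 - k + (k / 2 - 1)) = 0 by ring, Real.rpow_zero]
    rw [h1]
    have h3 := congrArg (fun x : ℝ ↦ (x : ℂ)) h2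
    push_cast at h3 ⊢
    linear_combination ((((d : ℕ) : ℝ) ^ ((k : ℝ) / 2) : ℝ) : ℂ) * h3
  rw [opB_eq, heckeT, finsum_eq_sum_of_fintype, ← mul_assoc, ← mul_assoc, hpow, Finset.mul_sum]
  refine Finset.sum_congr rfl fun β _ ↦ ?_
  rw [hBe, slash_mul k (by rw [β.out.2.1]; exact_mod_cast hm) (by rw [det_dil]; exact_mod_cast hd),
    slash_dil]

lemma tendsto_heckeT {N m : ℕ} {k : ℤ} {l : Filter ℝ} {F : ℍ → ℝ → ℂ} {f : ℍ → ℂ} (hm : 0 < m)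
    (h : ∀ z, Tendsto (F z) l (𝓝 (f z))) (τ : ℍ) :
    Tendsto (fun s ↦ heckeT N k m (fun z ↦ F z s) τ) l (𝓝 (heckeT N k m f τ)) := by
  have := finite_heckeQuotient (M := N) hm
  have := Fintype.ofFinite (Quotient (heckeSetoid N m))
  simp only [heckeT, finsum_eq_sum_of_fintype, slash_eq]
  exact (tendsto_finsetSum _ fun β _ ↦ (h _).const_mul _).const_mul _

end MaassPoincare

end

theorem proposition3p1 (k : ℤ) (hk : k ≤ 0) (hk2 : Even k) (N ν : ℕ) (hN : 0 < N) (hν : 0 < ν) :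
    (∀ (τ : UpperHalfPlane) (s : ℝ), 1 < s → Summable (MaassPoincare.term N k ν τ s)) ∧
    (∀ τ : UpperHalfPlane, Filter.Tendsto (MaassPoincare.series N k ν τ)
      (nhdsWithin (1 - (k : ℝ) / 2) (Set.Ioi (1 - (k : ℝ) / 2)))
      (nhds (MaassPoincare.poincare N k ν τ))) ∧
    ∀ τ : UpperHalfPlane,
      MaassPoincare.poincare N k ν τ =
        ∑ d ∈ (Nat.gcd N ν).divisors, ((ν / d : ℕ) : ℂ) ^ (1 - k) *
          MaassPoincare.opB d
            (MaassPoincare.heckeT (N / d) k (ν / d) (MaassPoincare.poincare (N / d) k 1)) τ := by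
  refine ⟨fun τ s hs ↦ MaassPoincare.summable_term N k hk hν τ hs,
    fun τ ↦ MaassPoincare.tendsto_series N hk hν τ, fun τ ↦ ?_⟩
  have hk' : (k : ℝ) ≤ 0 := by exact_mod_cast hk
  have hlim : Tendsto (MaassPoincare.series N k ν τ) (𝓝[>] (1 - (k : ℝ) / 2))
      (𝓝 (∑ d ∈ (Nat.gcd N ν).divisors, ((ν / d : ℕ) : ℂ) ^ (1 - k) *
        MaassPoincare.opB d (MaassPoincare.heckeT (N / d) k (ν / d)
          (MaassPoincare.poincare (N / d) k 1)) τ)) := by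
    refine Tendsto.congr' (f₁ := fun s ↦ ∑ d ∈ (Nat.gcd N ν).divisors,
      ((ν / d : ℕ) : ℂ) ^ (1 - k) * MaassPoincare.opB d (MaassPoincare.heckeT (N / d) k (ν / d)
        (fun z ↦ MaassPoincare.series (N / d) k 1 z s)) τ) ?_ ?_
    · filter_upwards [self_mem_nhdsWithin] with s hs
      rw [Set.mem_Ioi] at hs
      exact (MaassPoincare.series_eq_sum_heckeT hN hν hk hk2 (by linarith) τ).symm
    · refine tendsto_finsetSum _ fun d hd ↦ Tendsto.const_mul _ ?_
      have hdν := (MaassPoincare.dvd_of_mem_divisors_gcd hd).2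
      have hm : 0 < ν / d := Nat.div_pos (Nat.le_of_dvd hν hdν) (Nat.pos_of_dvd_of_pos hdν hν)
      exact MaassPoincare.tendsto_heckeT hm
        (fun z ↦ MaassPoincare.tendsto_series (N / d) hk one_pos z) _
  exact tendsto_nhds_unique (MaassPoincare.tendsto_series N hk hν τ) hlim
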